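/- **Setting.** Let $V$ be a real Hilbert space, compactly and injectively embedded in a real inner product space $W$. Let $a$ be a bounded, symmetric, coercive bilinear form on $V$ and $b$ a bounded, symmetric, positive definite bilinear form on $W$. (For the Stokes problem: $V=\{v\in H_0^1(\Omega)^2:\nabla\cdot v=0\}$, $W=L^2(\Omega)^2$, $a(u,v)=\int_\Omega\nabla u:\nabla v$, $b(u,v)=\int_\Omega u\cdot v$.) Write $$\|v\|_a=a(v,v)^{1/2},\qquad \|w\|_{-a}=\sup_{0\ne v\in V}\frac{b(w,v)}{\|v\|_a},$$ and let $T$ be the solution operator, $a(Tf,v)=b(f,v)$ for all $v\in V$. Consider the eigenvalue problem: find $(\lambda,u)\in\mathbb R\times V$ with $b(u,u)=1$ and $a(u,v)=\lambda b(u,v)$ for all $v\in V$; on a finite-dimensional subspace $S\subset V$ the discrete problem is the same with $u\in S$ and $v\in S$. Eigenvalues are numbered in increasing order from $1$, counted with multiplicity. Let $M(\lambda)$ be the set of eigenfunctions $w$ for $\lambda$ with $b(w,w)=1$, and for a finite-dimensional subspace $V_h\subset V$ put $$\eta_a(h)=\sup_{f\in V,\ \|f\|_a=1}\ \inf_{v\in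 V_h}\|Tf-v\|_a,\qquad \delta_h(\lambda)=\sup_{w\in M(\lambda)}\ \inf_{v\in V_h}\|w-v\|_a .$$ **Correction step.** Given finite-dimensional subspaces $V_H,V_{h_1}\subset V_{h_2}\subset V$ and $(\lambda_{h_1},u_{h_1})\in\mathbb R\times V_{h_1}$: 1. find $\tilde u_{h_2}\in V_{h_2}$ with $a(\tilde u_{h_2},v)=\lambda_{h_1}b(u_{h_1},v)$ for all $v\in V_{h_2}$; 2. let $(\lambda_{h_2},u_{h_2})$, $b(u_{h_2},u_{h_2})=1$, be an $i$-th eigenpair of the discrete problem on $V_{H,h_2}=V_H+\mathrm{span}\{\tilde u_{h_2}\}$. **Theorem.** Let $\lambda$ be the $i$-th eigenvalue of the problem, assume that it is simple, and let $u$ be an eigenfunction for $\lambda$ with $b(u,u)=1$. There is $\eta_0>0$ such that for every $C_0>0$ there is $C>0$ with the following property, for all finite-dimensional subspaces $V_H,V_{h_1}\subset V_{h_2}$ of $V$ such that $\eta_a(H)\le\eta_0$ (the coarse space is fine enough). If $(\lambda_{h_1},u_{h_1})\in\mathbb R\times V_{h_1}$ and $\varepsilon_{h_1}(\lambda)\in\mathbb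 R$ satisfy $$\|u-u_{h_1}\|_a\le C_0\,\varepsilon_{h_1}(\lambda),\qquad \|u-u_{h_1}\|_{-a}\le C_0\,\eta_a(H)\,\|u-u_{h_1}\|_a,\qquad |\lambda-\lambda_{h_1}|\le C_0\,\varepsilon_{h_1}(\lambda)^2,$$ then the correction step can be carried out, and each of its results $(\lambda_{h_2},u_{h_2})$, with the sign of $u_{h_2}$ chosen so that $b(u,u_{h_2})\ge0$, lies in $\mathbb R\times V_{h_2}$ and satisfies $$\|u-u_{h_2}\|_a\le C\,\varepsilon_{h_2}(\lambda),\qquad \|u-u_{h_2}\|_{-a}\le C\,\eta_a(H)\,\|u-u_{h_2}\|_a,\qquad |\lambda-\lambda_{h_2}|\le C\,\varepsilon_{h_2}(\lambda)^2,$$ where $\varepsilon_{h_2}(\lambda)=\eta_a(H)\,\varepsilon_{h_1}(\lambda)+\varepsilon_{h_1}(\lambda)^2+\delta_{h_2}(\lambda)$. The constants $\eta_0$ and $C$ do not depend on the subspaces, on $(\lambda_{h_1},u_{h_1})$ or on $\varepsilon_{h_1}(\lambda)$. -/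

import Mathlib

/-- The variational eigenvalue problem `a(u, v) = lam * b(u, v)`: `V` is a real Hilbert space that
embeds compactly into `W`, `a` is a bounded symmetric coercive form on `V`, and `b` is a bounded
symmetric positive definite form on `W`. -/
structure VariationalEigenproblem (V W : Type*)
    [NormedAddCommGroup V] [InnerProductSpace ℝ V] [CompleteSpace V]
    [NormedAddCommGroup W] [InnerProductSpace ℝ W] where
  emb : V →L[ℝ] W
  emb_injective : Function.Injective emb
  emb_compact : IsCompactOperator emb
  a : V →L[ℝ] V →L[ℝ] ℝ
  a_symm : ∀ v w, a v w = a w v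
  a_coercive : IsCoercive a
  b : W →L[ℝ] W →L[ℝ] ℝ
  b_symm : ∀ f g, b f g = b g f
  b_pos : ∀ f, f ≠ 0 → 0 < b f f

namespace VariationalEigenproblem

variable {V W : Type*}
  [NormedAddCommGroup V] [InnerProductSpace ℝ V] [CompleteSpace V]
  [NormedAddCommGroup W] [InnerProductSpace ℝ W]
  (P : VariationalEigenproblem V W)

/-- The form `b` on elements of `V`. -/
noncomputable def bV (v w : V) : ℝ := P.b (P.emb v) (P.emb w)

/-- The energy norm `‖v‖_a = a(v, v)^(1/2)`. -/
noncomputable def energyNorm (v : V) : ℝ := Real.sqrt (P.a v v)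

/-- The negative norm `‖w‖_{-a} = sup_{0 ≠ v ∈ V} b(w, v) / ‖v‖_a`. -/
noncomputable def negNorm (w : V) : ℝ :=
  sSup ((fun v : V => P.bV w v / P.energyNorm v) '' {v : V | v ≠ 0})

/-- The solution operator `T : W → V`, `a(T f, v) = b(f, v)` for all `v ∈ V`. -/
noncomputable def solOp (f : W) : V :=
  P.a_coercive.continuousLinearEquivOfBilin.symm
    ((InnerProductSpace.toDual ℝ V).symm ((P.b f).comp P.emb))

theorem solOp_spec (f : W) (v : V) : P.a (P.solOp f) v = P.b f (P.emb v) := by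
  rw [← P.a_coercive.continuousLinearEquivOfBilin_apply]
  simp [solOp]

/-- The best approximation error `inf_{v ∈ S} ‖w - v‖_a`. -/
noncomputable def bestApprox (S : Submodule ℝ V) (w : V) : ℝ :=
  sInf ((fun v : V => P.energyNorm (w - v)) '' (S : Set V))

/-- `η_a(S) = sup_{f ∈ V, ‖f‖_a = 1} inf_{v ∈ S} ‖T f - v‖_a`. -/
noncomputable def eta (S : Submodule ℝ V) : ℝ :=
  sSup ((fun f : V => P.bestApprox S (P.solOp (P.emb f))) '' {f : V | P.energyNorm f = 1})

/-- All `w ∈ S` with `a(w, v) = mu * b(w, v)` for all `v ∈ S`: the eigenspace (including `0`) of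
the Galerkin eigenvalue problem on `S`. For `S = ⊤` it is the eigenspace of the problem itself. -/
def eigenspace (S : Submodule ℝ V) (mu : ℝ) : Submodule ℝ V where
  carrier := {w | w ∈ S ∧ ∀ v ∈ S, P.a w v = mu * P.bV w v}
  zero_mem' := ⟨S.zero_mem, fun v _ => by simp [bV]⟩
  add_mem' := fun {x y} hx hy => ⟨S.add_mem hx.1 hy.1, fun v hv => by
    have h1 := hx.2 v hv
    have h2 := hy.2 v hv
    simp only [bV, map_add, add_apply] at *
    rw [h1, h2]; ring⟩
  smul_mem' := fun c x hx => ⟨S.smul_mem c hx.1, fun v hv => by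
    have h1 := hx.2 v hv
    simp only [bV, map_smul, smul_apply, smul_eq_mul] at *
    rw [h1]; ring⟩

/-- `(mu, w)` is an eigenpair on `S`, normalized by `b(w, w) = 1`. -/
def IsEigenpair (S : Submodule ℝ V) (mu : ℝ) (w : V) : Prop :=
  w ∈ P.eigenspace S mu ∧ P.bV w w = 1

/-- `mu` is the `i`-th eigenvalue on `S`, in increasing order, repeated according to multiplicity,
and counted from `i = 1`. -/
def IsIthEigenvalue (S : Submodule ℝ V) (i : ℕ) (mu : ℝ) : Prop :=
  Module.finrank ℝ (⨆ nu : Set.Iio mu, P.eigenspace S nu : Submodule ℝ V) < i ∧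
  i ≤ Module.finrank ℝ (⨆ nu : Set.Iic mu, P.eigenspace S nu : Submodule ℝ V)

/-- `δ_S(lam) = sup_{w ∈ M(lam)} inf_{v ∈ S} ‖w - v‖_a`, where `M(lam)` is the set of normalized
eigenfunctions of the problem for `lam`. -/
noncomputable def delta (S : Submodule ℝ V) (lam : ℝ) : ℝ :=
  sSup (P.bestApprox S '' {w : V | P.IsEigenpair ⊤ lam w})

/-- `(lam₂, u₂)` is a result of one correction step for the `i`-th eigenpair, started from
`(lam₁, u₁)`, with coarse space `VH` and fine space `V₂`: solve the source problem for `ut` on `V₂`,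
then take the `i`-th eigenpair of the problem on `VH + span {ut}`. -/
def IsCorrection (i : ℕ) (VH : Submodule ℝ V) (lam₁ : ℝ) (u₁ : V) (V₂ : Submodule ℝ V)
    (lam₂ : ℝ) (u₂ : V) : Prop :=
  ∃ ut ∈ V₂, (∀ v ∈ V₂, P.a ut v = lam₁ * P.bV u₁ v) ∧
    P.IsIthEigenvalue (VH ⊔ Submodule.span ℝ {ut}) i lam₂ ∧
    P.IsEigenpair (VH ⊔ Submodule.span ℝ {ut}) lam₂ u₂

end VariationalEigenproblem

/-! With `a` as inner product, `b` is represented by a compact symmetric operator `K`, the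
restriction of `T` to `V`. An eigenvalue `λ` becomes an eigenvalue `μ = 1/λ` of `K`, and the
Galerkin problem on `S` becomes the spectral problem of `P K P` with `P` the orthogonal projection
onto `S`. Moreover `‖w‖_{-a} = ‖K w‖` and `η_a(S) = ‖(1 - P) K‖`. The correction space `S` contains
`V_H`, so on it `‖(1 - P) K‖ ≤ η = η_a(H)`.

Duality gives `‖K (1 - P) x‖ ≤ η ‖(1 - P) x‖`, hence `‖K - P K P‖ ≤ 2 η`, and Weyl's inequality
gives `|1/λ₂ - 1/λ| ≤ 2 η`. Since `μ` is simple and nonzero, `K - μ` is bounded below on the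
complement of `u`; for small `η` so is `P K P - μ` on the complement of `u₂`
(`mul_norm_le_norm_galerkinOp_sub`). Applied to the part of `P u` orthogonal to `u₂`, whose residual
is at most `‖K (u - P u)‖`, this shows that `P u - u₂` is of order `η ‖u - P u‖`. All three error
bounds follow (`galerkin_eigenpair_error`), once `‖u - P u‖` is controlled by `ε₂`.

That control comes from the source problem: its solution lies in `S`, and the error of `u₁` enters
it only through `K (u - u₁)`, which is smaller by a factor `η`
(`norm_sub_starProjection_smul_map_le`). -/

open Module End

/-! ### Quadratic forms and spectral gaps of compact symmetric operators -/

section SpectralTheory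

variable {E : Type*} [NormedAddCommGroup E] [InnerProductSpace ℝ E]

/-- On the algebraic sum of the eigenspaces for eigenvalues at most `μ`, the quadratic form of a
symmetric operator is bounded by `μ`. -/
theorem LinearMap.IsSymmetric.inner_map_self_le_of_mem_iSup {T : E →ₗ[ℝ] E} (hT : T.IsSymmetric)
    {I : Set ℝ} {μ : ℝ} (hI : ∀ ν ∈ I, ν ≤ μ) {x : E} (hx : x ∈ ⨆ ν : I, eigenspace T ν) :
    inner ℝ (T x) x ≤ μ * ‖x‖ ^ 2 := by
  obtain ⟨f, hf, rfl⟩ := (Submodule.mem_iSup_iff_exists_finsupp _ _).1 hx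
  have horth : OrthogonalFamily ℝ (fun ν : I => eigenspace T ν)
      fun ν => (eigenspace T (ν : ℝ)).subtypeₗᵢ :=
    hT.orthogonalFamily_eigenspaces.comp Subtype.coe_injective
  have h1 := horth.inner_sum (fun ν => (ν : ℝ) • ⟨f ν, hf ν⟩) (fun ν => ⟨f ν, hf ν⟩) f.support
  have h2 := horth.norm_sum (fun ν => ⟨f ν, hf ν⟩) f.support
  simp only [Submodule.coe_subtypeₗᵢ, Submodule.subtype_apply, Submodule.coe_smul,
    Submodule.coe_norm] at h1 h2
  have hTf : T (f.sum fun _ y => y) = ∑ ν ∈ f.support, (ν : ℝ) • f ν := by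
    simp only [Finsupp.sum, map_sum]
    exact Finset.sum_congr rfl fun ν _ => mem_eigenspace_iff.1 (hf ν)
  rw [hTf]
  simp only [Finsupp.sum]
  rw [h1, h2, Finset.mul_sum]
  refine Finset.sum_le_sum fun ν _ => ?_
  rw [Submodule.coe_inner, Submodule.coe_smul, real_inner_smul_left, real_inner_self_eq_norm_sq]
  exact mul_le_mul_of_nonneg_right (hI _ ν.2) (sq_nonneg _)

theorem LinearMap.IsSymmetric.le_inner_map_self_of_mem_iSup {T : E →ₗ[ℝ] E} (hT : T.IsSymmetric)
    {I : Set ℝ} {μ : ℝ} (hI : ∀ ν ∈ I, μ ≤ ν) {x : E} (hx : x ∈ ⨆ ν : I, eigenspace T ν) :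
    μ * ‖x‖ ^ 2 ≤ inner ℝ (T x) x := by
  have hT' : (-T).IsSymmetric := fun x y => by simp [hT x y]
  have hle : (⨆ ν : I, eigenspace T ν) ≤ ⨆ ν : (Neg.neg ⁻¹' I : Set ℝ), eigenspace (-T) ν := by
    refine iSup_le fun ν => ?_
    refine le_trans ?_ (le_iSup (fun ν : (Neg.neg ⁻¹' I : Set ℝ) => eigenspace (-T) (ν : ℝ))
      ⟨-ν, by simp⟩)
    intro y hy
    rw [mem_eigenspace_iff] at hy ⊢
    simp [hy]
  have := hT'.inner_map_self_le_of_mem_iSup (μ := -μ)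
    (fun ν hν => by linarith [hI _ hν]) (hle hx)
  simp only [LinearMap.neg_apply, inner_neg_left] at this
  linarith

/-- The eigenspaces span a dense subspace, and the inequality is a closed condition. -/
theorem ContinuousLinearMap.inner_map_self_le_of_forall_hasEigenvalue_le [CompleteSpace E]
    {T : E →L[ℝ] E} (hc : IsCompactOperator T) (hT : T.IsSymmetric) {μ : ℝ}
    (hμ : ∀ ν, HasEigenvalue (T : End ℝ E) ν → ν ≤ μ) (x : E) :
    inner ℝ (T x) x ≤ μ * ‖x‖ ^ 2 := by
  have hbot := ContinuousLinearMap.orthogonalComplement_iSup_eigenspaces_eq_bot hc hT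
  rw [← Submodule.topologicalClosure_eq_top_iff] at hbot
  have hx : x ∈ (⨆ ν, eigenspace (T : End ℝ E) ν).topologicalClosure := hbot ▸ Submodule.mem_top
  rw [← SetLike.mem_coe, Submodule.topologicalClosure_coe] at hx
  have hclosed : IsClosed {x : E | inner ℝ (T x) x ≤ μ * ‖x‖ ^ 2} :=
    isClosed_le (by fun_prop) (by fun_prop)
  refine closure_minimal (fun y hy => ?_) hclosed hx
  refine LinearMap.IsSymmetric.inner_map_self_le_of_mem_iSup (I := Set.Iic μ) hT (fun ν hν => hν) ?_
  refine (iSup_le fun ν => ?_ : (⨆ ν, eigenspace (T : End ℝ E) ν) ≤ _) hy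
  by_cases h : ν ≤ μ
  · exact le_iSup (fun ν : Set.Iic μ => eigenspace (T : End ℝ E) (ν : ℝ)) ⟨ν, h⟩
  · have : eigenspace (T : End ℝ E) ν = ⊥ := by
      by_contra h'
      exact h (hμ ν (hasEigenvalue_iff.2 h'))
    simp [this]

/-- The complement is invariant, and the restriction of `T` to it has no eigenvalue above `μ`. -/
theorem ContinuousLinearMap.inner_map_self_le_of_mem_orthogonal [CompleteSpace E]
    {T : E →L[ℝ] E} (hc : IsCompactOperator T) (hT : T.IsSymmetric) {μ : ℝ} {x : E}
    (hx : x ∈ (⨆ ν : Set.Ioi μ, eigenspace (T : End ℝ E) ν)ᗮ) :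
    inner ℝ (T x) x ≤ μ * ‖x‖ ^ 2 := by
  set F := (⨆ ν : Set.Ioi μ, eigenspace (T : End ℝ E) ν)ᗮ with hF
  have hinv : ∀ y ∈ F, (T : End ℝ E) y ∈ F := by
    intro y hy
    rw [hF, ← Submodule.iInf_orthogonal, Submodule.mem_iInf] at hy ⊢
    exact fun ν => LinearMap.IsSymmetric.invariant_orthogonalComplement_eigenspace hT _ _ (hy ν)
  let R : F →L[ℝ] F := T.restrict hinv
  have hRc : IsCompactOperator R := hc.restrict' hinv
  have hRs : R.IsSymmetric := LinearMap.IsSymmetric.restrict_invariant hT hinv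
  refine ContinuousLinearMap.inner_map_self_le_of_forall_hasEigenvalue_le hRc hRs
    (fun ν hν => ?_) ⟨x, hx⟩
  by_contra! h
  obtain ⟨⟨v, hvF⟩, hv, hv0⟩ := hν.exists_hasEigenvector
  have hTv : T v = ν • v := congrArg Subtype.val (mem_eigenspace_iff.1 hv)
  have hvE : v ∈ ⨆ ν : Set.Ioi μ, eigenspace (T : End ℝ E) ν :=
    Submodule.mem_iSup_of_mem (⟨ν, h⟩ : Set.Ioi μ) (mem_eigenspace_iff.2 hTv)
  exact hv0 (Subtype.ext (Submodule.disjoint_def.1 (Submodule.orthogonal_disjoint _) v hvE hvF))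

theorem Submodule.exists_mem_orthogonal_of_finrank_lt {X Y : Submodule ℝ E}
    [FiniteDimensional ℝ Y] (h : finrank ℝ Y < finrank ℝ X) : ∃ x ∈ X, x ∈ Yᗮ ∧ x ≠ 0 := by
  -- An infinite-dimensional `X` would have `finrank` equal to `0`, which the strict inequality
  -- excludes.
  have : FiniteDimensional ℝ X := FiniteDimensional.of_finrank_pos (by omega)
  have hker := LinearMap.ker_ne_bot_of_finrank_lt
    (f := (Y.orthogonalProjectionOnto : E →ₗ[ℝ] Y) ∘ₗ X.subtype) h
  obtain ⟨x, hx, hx0⟩ := (Submodule.ne_bot_iff _).1 hker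
  refine ⟨x, x.2, ?_, by simpa using hx0⟩
  simpa using hx

/-- Weyl's inequality for the counting functions of the eigenvalues of two operators. -/
theorem ContinuousLinearMap.le_add_of_finrank_iSup_eigenspace_lt [CompleteSpace E]
    {A B : E →L[ℝ] E} (hc : IsCompactOperator A) (hA : A.IsSymmetric) (hB : B.IsSymmetric)
    {μ κ c : ℝ} (hAB : ∀ x, ‖B x - A x‖ ≤ c * ‖x‖)
    [FiniteDimensional ℝ (⨆ ν : Set.Ioi μ, eigenspace (A : End ℝ E) ν : Submodule ℝ E)]
    (h : finrank ℝ (⨆ ν : Set.Ioi μ, eigenspace (A : End ℝ E) ν : Submodule ℝ E) <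
      finrank ℝ (⨆ ν : Set.Ici κ, eigenspace (B : End ℝ E) ν : Submodule ℝ E)) :
    κ ≤ μ + c := by
  -- The test vector of the min-max principle: the form of `B` is at least `κ` on it, that of `A` at
  -- most `μ`.
  obtain ⟨x, hxB, hxA, hx0⟩ := Submodule.exists_mem_orthogonal_of_finrank_lt h
  have h1 := ContinuousLinearMap.inner_map_self_le_of_mem_orthogonal hc hA hxA
  have h2 : κ * ‖x‖ ^ 2 ≤ inner ℝ (B x) x :=
    LinearMap.IsSymmetric.le_inner_map_self_of_mem_iSup hB (fun ν hν => hν) hxB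
  have h3 : inner ℝ (B x) x - inner ℝ (A x) x ≤ c * ‖x‖ ^ 2 := by
    rw [← inner_sub_left]
    refine (real_inner_le_norm _ _).trans ?_
    have := mul_le_mul_of_nonneg_right (hAB x) (norm_nonneg x)
    linarith
  have : 0 < ‖x‖ ^ 2 := by positivity
  exact le_of_mul_le_mul_right (by linarith) this

/-- A compact symmetric operator minus a nonzero simple eigenvalue is bounded below on the
orthogonal complement of the eigenvector. -/
theorem IsCompactOperator.exists_mul_norm_le_of_eigenspace_le [CompleteSpace E]
    {T : E →L[ℝ] E} (hc : IsCompactOperator T) (hT : T.IsSymmetric) {μ : ℝ} (hμ : μ ≠ 0) {u : E}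
    (hu : T u = μ • u) (hle : eigenspace (T : End ℝ E) μ ≤ ℝ ∙ u) :
    ∃ γ, 0 < γ ∧ ∀ y, inner ℝ u y = 0 → γ * ‖y‖ ≤ ‖T y - μ • y‖ := by
  have hinv : ∀ y ∈ (ℝ ∙ u)ᗮ, (T : End ℝ E) y ∈ (ℝ ∙ u)ᗮ := by
    intro y hy
    rw [Submodule.mem_orthogonal_singleton_iff_inner_right] at hy ⊢
    have : inner ℝ (T u) y = inner ℝ u (T y) := hT u y
    rw [hu, real_inner_smul_left, hy, mul_zero] at this
    exact this.symm
  let R : (ℝ ∙ u)ᗮ →L[ℝ] (ℝ ∙ u)ᗮ := T.restrict hinv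
  have hRc : IsCompactOperator R := hc.restrict' hinv
  have hne : ¬ HasEigenvalue (R : End ℝ (ℝ ∙ u)ᗮ) μ := by
    intro h
    obtain ⟨⟨v, hvF⟩, hv, hv0⟩ := h.exists_hasEigenvector
    have hTv : T v = μ • v := congrArg Subtype.val (mem_eigenspace_iff.1 hv)
    exact hv0 (Subtype.ext (Submodule.disjoint_def.1 (Submodule.orthogonal_disjoint _) v
      (hle (mem_eigenspace_iff.2 hTv)) hvF))
  -- Fredholm alternative on the complement, where `μ` is no longer an eigenvalue.
  have := hRc.antilipschitz_of_not_hasEigenvalue hμ hne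
  rw [antilipschitzWith_iff_exists_mul_le_norm] at this
  obtain ⟨γ, hγ, h⟩ := this
  refine ⟨γ, hγ, fun y hy => ?_⟩
  exact h ⟨y, Submodule.mem_orthogonal_singleton_iff_inner_right.2 hy⟩

end SpectralTheory

/-! ### Error analysis of Galerkin eigenpairs -/

section Galerkin

variable {E : Type*} [NormedAddCommGroup E] [InnerProductSpace ℝ E]

/-- The Galerkin compression `P K P` of an operator `K` to a subspace with projection `P`. -/
noncomputable def galerkinOp (K : E →L[ℝ] E) (S : Submodule ℝ E) [S.HasOrthogonalProjection] :
    E →L[ℝ] E :=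
  S.starProjection ∘L K ∘L S.starProjection

variable {K : E →L[ℝ] E} {S : Submodule ℝ E} [S.HasOrthogonalProjection]

theorem galerkinOp_apply (x : E) :
    galerkinOp K S x = S.starProjection (K (S.starProjection x)) := rfl

theorem galerkinOp_apply_of_mem {x : E} (hx : x ∈ S) :
    galerkinOp K S x = S.starProjection (K x) := by
  rw [galerkinOp_apply, Submodule.starProjection_eq_self_iff.2 hx]

theorem galerkinOp_eq_self (hS : S = ⊤) : galerkinOp K S = K := by
  have hmem (x : E) : x ∈ S := hS ▸ Submodule.mem_top
  ext x
  rw [galerkinOp_apply_of_mem (hmem x), Submodule.starProjection_eq_self_iff.2 (hmem _)]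

theorem isSymmetric_galerkinOp (hK : K.IsSymmetric) : (galerkinOp K S).IsSymmetric := by
  intro x y
  have h (x y : E) : inner ℝ (K x) y = inner ℝ x (K y) := hK x y
  simp only [ContinuousLinearMap.coe_coe, galerkinOp_apply]
  rw [Submodule.inner_starProjection_left_eq_right, h,
    Submodule.inner_starProjection_left_eq_right]

theorem isCompactOperator_galerkinOp (hK : IsCompactOperator K) :
    IsCompactOperator (galerkinOp K S) :=
  (hK.comp_clm S.starProjection).clm_comp S.starProjection

/-- The compression vanishes on `Sᗮ`, so only its nonzero eigenvalues are sure to belong to the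
Galerkin problem. -/
theorem mem_eigenspace_galerkinOp {μ : ℝ} (hμ : μ ≠ 0) {x : E} :
    x ∈ eigenspace (galerkinOp K S : End ℝ E) μ ↔ x ∈ S ∧ S.starProjection (K x) = μ • x := by
  rw [mem_eigenspace_iff, ContinuousLinearMap.coe_coe]
  constructor
  · intro h
    have hx : x ∈ S := by
      have : μ • x ∈ S := h ▸ Submodule.starProjection_apply_mem S _
      exact (S.smul_mem_iff hμ).1 this
    exact ⟨hx, by rw [← h, galerkinOp_apply_of_mem hx]⟩
  · rintro ⟨hx, h⟩
    rw [galerkinOp_apply_of_mem hx, h]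

theorem norm_sub_starProjection_le_norm (x : E) :
    ‖x - S.starProjection x‖ ≤ ‖x‖ := by
  rw [← Submodule.starProjection_orthogonal_val]
  exact Submodule.norm_starProjection_apply_le _ _

theorem norm_sub_starProjection_le_norm_sub
    (x : E) {y : E} (hy : y ∈ S) : ‖x - S.starProjection x‖ ≤ ‖x - y‖ := by
  rw [Submodule.starProjection_minimal]
  exact ciInf_le ⟨0, by rintro _ ⟨y, rfl⟩; positivity⟩ (⟨y, hy⟩ : S)

variable {η : ℝ}

/-- The Aubin–Nitsche duality argument: for `z` orthogonal to `S`, `‖K z‖² = (z, (1 - P) K (K z)) ≤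
‖z‖ η ‖K z‖`. -/
theorem norm_map_sub_starProjection_le (hK : K.IsSymmetric)
    (hη : ∀ x, ‖K x - S.starProjection (K x)‖ ≤ η * ‖x‖) (x : E) :
    ‖K (x - S.starProjection x)‖ ≤ η * ‖x - S.starProjection x‖ := by
  set z := x - S.starProjection x
  have hzS : z ∈ Sᗮ := S.sub_starProjection_mem_orthogonal x
  rcases (norm_nonneg (K z)).eq_or_lt with h0 | hpos
  · rw [← h0]
    rcases (norm_nonneg z).eq_or_lt with h0' | hpos'
    · simp [← h0']
    · exact (norm_nonneg _).trans (hη z)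
  have h1 : ‖K z‖ * ‖K z‖ = inner ℝ z (K (K z) - S.starProjection (K (K z))) := by
    rw [inner_sub_right, Submodule.inner_left_of_mem_orthogonal
      (Submodule.starProjection_apply_mem S _) hzS, sub_zero, ← real_inner_self_eq_norm_mul_norm]
    exact hK z (K z)
  have h2 : ‖K z‖ * ‖K z‖ ≤ ‖z‖ * (η * ‖K z‖) :=
    h1 ▸ (real_inner_le_norm _ _).trans (mul_le_mul_of_nonneg_left (hη _) (norm_nonneg _))
  exact le_of_mul_le_mul_right (by linarith) hpos

/-- From `K - P K P = (1 - P) K + P K (1 - P)`; duality bounds the second term by `η` as well. -/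
theorem norm_sub_galerkinOp_le (hK : K.IsSymmetric)
    (hη : ∀ x, ‖K x - S.starProjection (K x)‖ ≤ η * ‖x‖) (hη0 : 0 ≤ η) (x : E) :
    ‖K x - galerkinOp K S x‖ ≤ 2 * η * ‖x‖ := by
  have h1 : K x - galerkinOp K S x =
      (K x - S.starProjection (K x)) + S.starProjection (K (x - S.starProjection x)) := by
    simp [galerkinOp_apply, map_sub]
  have h2 : ‖x - S.starProjection x‖ ≤ ‖x‖ := norm_sub_starProjection_le_norm x
  have h3 := S.norm_starProjection_apply_le (K (x - S.starProjection x))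
  have h4 := norm_map_sub_starProjection_le hK hη x
  have h5 := mul_le_mul_of_nonneg_left h2 hη0
  rw [h1]
  refine (norm_add_le _ _).trans ?_
  linarith [hη x]

variable {μ μ₂ γ : ℝ} {u u₂ : E}

/-- If the Galerkin space resolves `K` well, then the Galerkin operator minus `μ` is bounded below
on the orthogonal complement of the Galerkin eigenvector in the Galerkin space. -/
theorem mul_norm_le_norm_galerkinOp_sub (hK : K.IsSymmetric)
    (hη : ∀ x, ‖K x - S.starProjection (K x)‖ ≤ η * ‖x‖) (hη0 : 0 ≤ η)
    (hu0 : u ≠ 0) (hu : K u = μ • u)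
    (hγ : ∀ y, inner ℝ u y = 0 → γ * ‖y‖ ≤ ‖K y - μ • y‖) (hγ0 : 0 < γ) (hηγ : η ≤ γ / 16)
    (hu₂0 : u₂ ≠ 0) (hu₂ : galerkinOp K S u₂ = μ₂ • u₂) (hμ₂ : |μ₂ - μ| ≤ 2 * η)
    {x : E} (hx : inner ℝ x u₂ = 0) :
    γ / 2 * ‖x‖ ≤ ‖galerkinOp K S x - μ • x‖ := by
  have hu2pos : 0 < ‖u‖ ^ 2 := by positivity
  have hdec (z : E) : ∃ t : ℝ, ∃ y : E, z = t • u + y ∧ inner ℝ u y = 0 ∧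
      K z - μ • z = K y - μ • y := by
    refine ⟨inner ℝ u z / ‖u‖ ^ 2, z - (inner ℝ u z / ‖u‖ ^ 2) • u, by simp, ?_, ?_⟩
    · rw [inner_sub_right, real_inner_smul_right, real_inner_self_eq_norm_sq]
      field_simp
      simp
    · rw [map_sub, map_smul, hu]
      module
  have hG := norm_sub_galerkinOp_le hK hη hη0
  obtain ⟨α, r, hr, hur, hKr⟩ := hdec u₂
  obtain ⟨τ, y, hy, huy, hKy⟩ := hdec x
  have hn : 0 < ‖u₂‖ := norm_pos_iff.2 hu₂0
  -- `u₂` nearly solves the exact problem, with residual at most `4 η ‖u₂‖`, so the gap keeps it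
  -- close to the line of `u`.
  have hr4 : ‖r‖ ≤ ‖u₂‖ / 4 := by
    have h1 : K u₂ - μ • u₂ = (K u₂ - galerkinOp K S u₂) + (μ₂ - μ) • u₂ := by
      rw [hu₂]; module
    have h2 : ‖K r - μ • r‖ ≤ 4 * η * ‖u₂‖ := by
      rw [← hKr, h1]
      refine (norm_add_le _ _).trans ?_
      rw [norm_smul, Real.norm_eq_abs]
      have := mul_le_mul_of_nonneg_right hμ₂ hn.le
      linarith [hG u₂]
    have h3 := (hγ r hur).trans h2
    have h4 := mul_le_mul_of_nonneg_right hηγ hn.le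
    have : γ * ‖r‖ ≤ γ * (‖u₂‖ / 4) := by linarith
    exact le_of_mul_le_mul_left this hγ0
  have hα : 3 / 4 * ‖u₂‖ ≤ ‖α • u‖ := by
    have : ‖u₂‖ ≤ ‖α • u‖ + ‖r‖ := by
      conv_lhs => rw [hr]
      exact norm_add_le _ _
    linarith
  -- Orthogonality of `x` to `u₂` makes `x` almost orthogonal to `u`, so the gap for `y` carries
  -- over to `x`.
  have hτ : ‖τ • u‖ ≤ ‖y‖ / 3 := by
    have h0 : τ * α * ‖u‖ ^ 2 + inner ℝ y r = 0 := by
      rw [hy, hr] at hx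
      simp only [inner_add_left, inner_add_right, real_inner_smul_left, real_inner_smul_right,
        real_inner_self_eq_norm_sq, hur, real_inner_comm u y, huy] at hx
      linarith
    have h1 : ‖τ • u‖ * ‖α • u‖ = |τ * α * ‖u‖ ^ 2| := by
      rw [norm_smul, norm_smul, Real.norm_eq_abs, Real.norm_eq_abs, abs_mul, abs_mul,
        abs_of_nonneg hu2pos.le]
      ring
    have h2 : ‖τ • u‖ * ‖α • u‖ ≤ ‖y‖ * (‖u₂‖ / 4) := by
      rw [h1, show τ * α * ‖u‖ ^ 2 = -inner ℝ y r by linarith, abs_neg]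
      exact (abs_real_inner_le_norm _ _).trans
        (mul_le_mul_of_nonneg_left hr4 (norm_nonneg _))
    have h3 := mul_le_mul_of_nonneg_left hα (norm_nonneg (τ • u))
    exact le_of_mul_le_mul_right (by linarith) hn
  have hxy : ‖x‖ ≤ 4 / 3 * ‖y‖ := by
    have : ‖x‖ ≤ ‖τ • u‖ + ‖y‖ := by
      conv_lhs => rw [hy]
      exact norm_add_le _ _
    linarith
  have h1 : ‖K x - μ • x‖ ≤ ‖K x - galerkinOp K S x‖ + ‖galerkinOp K S x - μ • x‖ := by
    rw [show K x - μ • x = (K x - galerkinOp K S x) + (galerkinOp K S x - μ • x) by abel]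
    exact norm_add_le _ _
  have h2 := hγ y huy
  rw [← hKy] at h2
  have h3 := mul_le_mul_of_nonneg_left hxy hγ0.le
  have h4 := mul_le_mul_of_nonneg_right hηγ (norm_nonneg x)
  have h5 := mul_nonneg hγ0.le (norm_nonneg x)
  linarith [hG x]

/-- The vector on the left is the part of `P u` orthogonal to `u₂`. Its residual under `P K P - μ`
is `-P K (u - P u)` up to a multiple of `u₂`, and that multiple drops out because the residual is
itself orthogonal to `u₂`. -/
theorem norm_starProjection_sub_smul_le (hK : K.IsSymmetric)
    (hη : ∀ x, ‖K x - S.starProjection (K x)‖ ≤ η * ‖x‖) (hη0 : 0 ≤ η)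
    (hu0 : u ≠ 0) (hu : K u = μ • u)
    (hγ : ∀ y, inner ℝ u y = 0 → γ * ‖y‖ ≤ ‖K y - μ • y‖) (hγ0 : 0 < γ) (hηγ : η ≤ γ / 16)
    (hu₂0 : u₂ ≠ 0) (hu₂S : u₂ ∈ S) (hu₂ : galerkinOp K S u₂ = μ₂ • u₂)
    (hμ₂ : |μ₂ - μ| ≤ 2 * η) :
    ‖S.starProjection u - (inner ℝ u u₂ / ‖u₂‖ ^ 2) • u₂‖ ≤
      2 / γ * (η * ‖u - S.starProjection u‖) := by
  set β : ℝ := inner ℝ u u₂ / ‖u₂‖ ^ 2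
  set x := S.starProjection u - β • u₂ with hxdef
  have hu₂pos : 0 < ‖u₂‖ ^ 2 := by positivity
  have hx : inner ℝ x u₂ = 0 := by
    rw [hxdef, inner_sub_left, Submodule.inner_starProjection_left_eq_right,
      Submodule.starProjection_eq_self_iff.2 hu₂S, real_inner_smul_left,
      real_inner_self_eq_norm_sq, div_mul_cancel₀ _ hu₂pos.ne', sub_self]
  have hGs (x y : E) : inner ℝ (galerkinOp K S x) y = inner ℝ x (galerkinOp K S y) :=
    isSymmetric_galerkinOp hK x y
  set w := galerkinOp K S x - μ • x with hw
  have hwu : inner ℝ w u₂ = 0 := by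
    rw [hw, inner_sub_left, hGs, hu₂, real_inner_smul_right, real_inner_smul_left, hx]
    simp
  have hweq : w = -S.starProjection (K (u - S.starProjection u)) - (β * (μ₂ - μ)) • u₂ := by
    have h1 : galerkinOp K S (S.starProjection u) = S.starProjection (K (S.starProjection u)) :=
      galerkinOp_apply_of_mem (Submodule.starProjection_apply_mem S u)
    rw [hw, hxdef, map_sub, map_smul, hu₂, h1, map_sub, hu, map_sub, map_smul]
    module
  have hwle : ‖w‖ ≤ η * ‖u - S.starProjection u‖ := by
    have h1 : ‖w‖ * ‖w‖ = inner ℝ w (-S.starProjection (K (u - S.starProjection u))) := by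
      rw [← real_inner_self_eq_norm_mul_norm]
      refine (congrArg (inner ℝ w) hweq).trans ?_
      rw [inner_sub_right, real_inner_smul_right, hwu, mul_zero, sub_zero]
    have h2 : ‖w‖ * ‖w‖ ≤ ‖w‖ * (η * ‖u - S.starProjection u‖) := by
      rw [h1]
      refine (real_inner_le_norm _ _).trans (mul_le_mul_of_nonneg_left ?_ (norm_nonneg _))
      rw [norm_neg]
      exact (S.norm_starProjection_apply_le _).trans (norm_map_sub_starProjection_le hK hη u)
    rcases (norm_nonneg w).eq_or_lt with h0 | hpos
    · rw [← h0]; positivity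
    · exact le_of_mul_le_mul_left h2 hpos
  have := (mul_norm_le_norm_galerkinOp_sub hK hη hη0 hu0 hu hγ hγ0 hηγ hu₂0 hu₂ hμ₂ hx).trans hwle
  rw [div_mul_eq_mul_div, le_div_iff₀ hγ0]
  linarith

/-- The error between the projection of a simple eigenvector and the Galerkin eigenvector is of
higher order than the projection error. -/
theorem norm_starProjection_sub_le (hK : K.IsSymmetric)
    (hη : ∀ x, ‖K x - S.starProjection (K x)‖ ≤ η * ‖x‖) (hη0 : 0 ≤ η)
    (hμ : 0 < μ) (hu : K u = μ • u) (hu1 : inner ℝ (K u) u = 1)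
    (hγ : ∀ y, inner ℝ u y = 0 → γ * ‖y‖ ≤ ‖K y - μ • y‖) (hγ0 : 0 < γ) (hηγ : η ≤ γ / 16)
    (hηm : η ≤ μ / 4) (hu₂S : u₂ ∈ S) (hu₂ : galerkinOp K S u₂ = μ₂ • u₂)
    (hu₂1 : inner ℝ (K u₂) u₂ = 1) (hsign : 0 ≤ inner ℝ (K u) u₂) (hμ₂ : |μ₂ - μ| ≤ 2 * η) :
    ‖S.starProjection u - u₂‖ ≤
      (2 / γ + (2 * ‖u‖ + ‖K‖ * (2 / γ) * (2 * ‖u‖)) * Real.sqrt (2 / μ)) *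
        (η * ‖u - S.starProjection u‖) := by
  have hu0 : u ≠ 0 := by rintro rfl; simp at hu1
  have hu₂0 : u₂ ≠ 0 := by rintro rfl; simp at hu₂1
  have hx := norm_starProjection_sub_smul_le hK hη hη0 hu0 hu hγ hγ0 hηγ hu₂0 hu₂S hu₂ hμ₂
  set β : ℝ := inner ℝ u u₂ / ‖u₂‖ ^ 2 with hβ
  set p := S.starProjection u
  set δ := ‖u - p‖
  have hn : 0 < ‖u₂‖ := norm_pos_iff.2 hu₂0
  have hKs (x y : E) : inner ℝ (K x) y = inner ℝ x (K y) := hK x y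
  have hpu : ‖p‖ ≤ ‖u‖ := S.norm_starProjection_apply_le u
  have hβ0 : 0 ≤ β := by
    rw [hu, real_inner_smul_left] at hsign
    exact div_nonneg (nonneg_of_mul_nonneg_right hsign hμ) (sq_nonneg _)
  have hβu : ‖β • u₂‖ ≤ ‖u‖ := by
    rw [norm_smul, Real.norm_eq_abs, abs_of_nonneg hβ0, hβ, div_mul_eq_mul_div,
      div_le_iff₀ (by positivity)]
    have := mul_le_mul_of_nonneg_right (real_inner_le_norm u u₂) hn.le
    linarith
  -- Here `‖u₂‖² = 1/μ₂`, and `μ₂ ≥ μ/2` because `2 η ≤ μ/2`.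
  have hu₂norm : ‖u₂‖ ≤ Real.sqrt (2 / μ) := by
    apply Real.le_sqrt_of_sq_le
    have h1 : μ₂ * ‖u₂‖ ^ 2 = 1 := by
      rw [← hu₂1, ← real_inner_self_eq_norm_sq, ← real_inner_smul_left, ← hu₂,
        galerkinOp_apply_of_mem hu₂S, Submodule.inner_starProjection_left_eq_right,
        Submodule.starProjection_eq_self_iff.2 hu₂S]
    have h2 : μ / 2 ≤ μ₂ := by linarith [(abs_le.1 hμ₂).1]
    rw [le_div_iff₀ hμ]
    have := mul_le_mul_of_nonneg_right h2 (sq_nonneg ‖u₂‖)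
    linarith
  -- The normalizations give `1 - β² = (K u, u) - β² (K u₂, u₂)`, a difference of squares for the
  -- form of `K`, split at `p`. The sign condition `β ≥ 0` passes from `1 - β²` to `1 - β`.
  have hβ1 : |1 - β| ≤ (2 * ‖u‖ + ‖K‖ * (2 / γ) * (2 * ‖u‖)) * (η * δ) := by
    have h1 : |1 - β| ≤ |1 - β ^ 2| := by
      rw [show 1 - β ^ 2 = (1 - β) * (1 + β) by ring, abs_mul,
        abs_of_nonneg (by linarith : 0 ≤ 1 + β)]
      exact le_mul_of_one_le_right (abs_nonneg _) (by linarith)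
    have h2 : 1 - β ^ 2 = inner ℝ (K (u - p)) (u + p) +
        inner ℝ (K (p - β • u₂)) (p + β • u₂) := by
      have e1 : inner ℝ (K u) p = inner ℝ (K p) u := by rw [hKs, real_inner_comm]
      have e2 : inner ℝ (K p) u₂ = inner ℝ (K u₂) p := by rw [hKs, real_inner_comm]
      simp only [map_sub, map_smul, inner_sub_left, inner_add_right, real_inner_smul_left,
        real_inner_smul_right, hu1, hu₂1, e1, e2]
      ring
    have h3 : |inner ℝ (K (u - p)) (u + p)| ≤ η * δ * (2 * ‖u‖) := by
      refine (abs_real_inner_le_norm _ _).trans (mul_le_mul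
        (norm_map_sub_starProjection_le hK hη u) ?_ (norm_nonneg _) (by positivity))
      exact (norm_add_le _ _).trans (by linarith)
    have h4 : |inner ℝ (K (p - β • u₂)) (p + β • u₂)| ≤
        ‖K‖ * (2 / γ * (η * δ)) * (2 * ‖u‖) := by
      refine (abs_real_inner_le_norm _ _).trans (mul_le_mul
        ((K.le_opNorm _).trans (mul_le_mul_of_nonneg_left hx (norm_nonneg _))) ?_
        (norm_nonneg _) (by positivity))
      exact (norm_add_le _ _).trans (by linarith)
    refine h1.trans ?_
    rw [h2]
    refine (abs_add_le _ _).trans ?_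
    linarith
  have h1 : p - u₂ = (p - β • u₂) - (1 - β) • u₂ := by module
  rw [h1]
  refine (norm_sub_le _ _).trans ?_
  rw [norm_smul, Real.norm_eq_abs]
  have h2 := mul_le_mul hβ1 hu₂norm hn.le ((abs_nonneg _).trans hβ1)
  linarith

/-- Error estimates for a Galerkin eigenpair in terms of the projection error of the exact one. -/
theorem galerkin_eigenpair_error (hK : K.IsSymmetric) (hμ : 0 < μ) (hu : K u = μ • u)
    (hu1 : inner ℝ (K u) u = 1)
    (hγ : ∀ y, inner ℝ u y = 0 → γ * ‖y‖ ≤ ‖K y - μ • y‖) (hγ0 : 0 < γ) :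
    ∃ C, 0 < C ∧ ∀ (S : Submodule ℝ E) [S.HasOrthogonalProjection] (η μ₂ : ℝ) (u₂ : E),
      (∀ x, ‖K x - S.starProjection (K x)‖ ≤ η * ‖x‖) → 0 ≤ η → η ≤ γ / 16 → η ≤ μ / 4 →
      u₂ ∈ S → galerkinOp K S u₂ = μ₂ • u₂ → inner ℝ (K u₂) u₂ = 1 → 0 ≤ inner ℝ (K u) u₂ →
      |μ₂ - μ| ≤ 2 * η →
      ‖u - u₂‖ ≤ C * ‖u - S.starProjection u‖ ∧ ‖K (u - u₂)‖ ≤ C * (η * ‖u - u₂‖) ∧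
        |μ⁻¹ - μ₂⁻¹| ≤ C * ‖u - u₂‖ ^ 2 := by
  set C₁ : ℝ := 2 / γ + (2 * ‖u‖ + ‖K‖ * (2 / γ) * (2 * ‖u‖)) * Real.sqrt (2 / μ)
  have hC₁ : 0 ≤ C₁ := by positivity
  refine ⟨1 + C₁ * γ + ‖K‖ * C₁ + μ⁻¹ * ‖K‖, by positivity, ?_⟩
  intro S _ η μ₂ u₂ hη hη0 hηγ hηm hu₂S hu₂ hu₂1 hsign hμ₂
  have hd := norm_starProjection_sub_le hK hη hη0 hμ hu hu1 hγ hγ0 hηγ hηm hu₂S hu₂ hu₂1 hsign hμ₂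
  change _ ≤ C₁ * _ at hd
  have hKs (x y : E) : inner ℝ (K x) y = inner ℝ x (K y) := hK x y
  have hKn := norm_map_sub_starProjection_le hK hη u
  set p := S.starProjection u
  have hsplit : u - u₂ = (u - p) + (p - u₂) := by abel
  -- Best approximation turns bounds by `‖u - p‖` into bounds by the actual error `‖u - u₂‖`.
  have hδe : ‖u - p‖ ≤ ‖u - u₂‖ := norm_sub_starProjection_le_norm_sub u hu₂S
  have hμinv : 0 < μ⁻¹ := inv_pos.2 hμ
  have hN := norm_nonneg K
  have hδ0 := norm_nonneg (u - p)
  refine ⟨?_, ?_, ?_⟩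
  · have h1 : ‖u - u₂‖ ≤ ‖u - p‖ + C₁ * (η * ‖u - p‖) := by
      rw [hsplit]
      exact (norm_add_le _ _).trans (by linarith)
    have h2 : C₁ * (η * ‖u - p‖) ≤ C₁ * (γ * ‖u - p‖) := by gcongr; linarith
    have h3 : 0 ≤ (‖K‖ * C₁ + μ⁻¹ * ‖K‖) * ‖u - p‖ := by positivity
    linarith
  · have h1 : ‖K (u - u₂)‖ ≤ η * ‖u - p‖ + ‖K‖ * (C₁ * (η * ‖u - p‖)) := by
      rw [hsplit, map_add]
      refine (norm_add_le _ _).trans (add_le_add hKn ?_)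
      exact (K.le_opNorm _).trans (mul_le_mul_of_nonneg_left hd hN)
    have h2 : η * ‖u - p‖ ≤ η * ‖u - u₂‖ := by gcongr
    have h3 : 0 ≤ (C₁ * γ + μ⁻¹ * ‖K‖) * (η * ‖u - u₂‖) := by positivity
    have h4 : ‖K‖ * (C₁ * (η * ‖u - p‖)) ≤ ‖K‖ * (C₁ * (η * ‖u - u₂‖)) := by gcongr
    linarith
  · have hμ₂0 : μ₂ ≠ 0 := by
      have := (abs_le.1 hμ₂).1
      intro h
      rw [h] at this
      linarith
    have e1 : ‖u‖ ^ 2 = μ⁻¹ := by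
      rw [hu, real_inner_smul_left, real_inner_self_eq_norm_sq] at hu1
      exact eq_inv_of_mul_eq_one_right hu1
    have e2 : ‖u₂‖ ^ 2 = μ₂⁻¹ := by
      have : μ₂ * ‖u₂‖ ^ 2 = 1 := by
        rw [← hu₂1, ← real_inner_self_eq_norm_sq, ← real_inner_smul_left, ← hu₂,
          galerkinOp_apply_of_mem hu₂S, Submodule.inner_starProjection_left_eq_right,
          Submodule.starProjection_eq_self_iff.2 hu₂S]
      exact eq_inv_of_mul_eq_one_right this
    have e3 : inner ℝ u u₂ = μ⁻¹ * inner ℝ (K u) u₂ := by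
      rw [hu, real_inner_smul_left, inv_mul_cancel_left₀ hμ.ne']
    -- The identity `a(e, e) - λ b(e, e) = λ₂ - λ` for `e = u - u₂`, the source of the quadratic
    -- eigenvalue error.
    have e4 : ‖u - u₂‖ ^ 2 - μ⁻¹ * inner ℝ (K (u - u₂)) (u - u₂) = μ₂⁻¹ - μ⁻¹ := by
      have : inner ℝ (K u₂) u = inner ℝ (K u) u₂ := by rw [hKs, real_inner_comm]
      rw [norm_sub_sq_real, e1, e2, e3]
      simp only [map_sub, inner_sub_left, inner_sub_right, hu1, hu₂1, this]
      ring
    have h1 : |inner ℝ (K (u - u₂)) (u - u₂)| ≤ ‖K‖ * ‖u - u₂‖ ^ 2 := by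
      refine (abs_real_inner_le_norm _ _).trans ?_
      have := mul_le_mul_of_nonneg_right (K.le_opNorm (u - u₂)) (norm_nonneg (u - u₂))
      linarith
    have h2 : |μ⁻¹ - μ₂⁻¹| ≤ ‖u - u₂‖ ^ 2 + μ⁻¹ * (‖K‖ * ‖u - u₂‖ ^ 2) := by
      rw [abs_sub_comm, ← e4]
      refine (abs_sub _ _).trans ?_
      rw [abs_mul, abs_of_pos hμinv, abs_of_nonneg (sq_nonneg ‖u - u₂‖)]
      gcongr
    have h3 : 0 ≤ (C₁ * γ + ‖K‖ * C₁) * ‖u - u₂‖ ^ 2 := by positivity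
    linarith

end Galerkin

/-! ### Passage to the energy inner product -/

section Renorming

/-- A complete space is linearly homeomorphic to a Hilbert space carrying a given inner product
with an equivalent norm. -/
theorem InnerProductSpace.Core.exists_continuousLinearEquiv.{v} {V : Type*} [NormedAddCommGroup V]
    [NormedSpace ℝ V] [CompleteSpace V] {F : Type v} [AddCommGroup F] [Module ℝ F]
    (cd : InnerProductSpace.Core ℝ F) (L : V ≃ₗ[ℝ] F) {c C : ℝ} (hc : 0 < c)
    (hlow : ∀ v, c * ‖v‖ ^ 2 ≤ cd.inner (L v) (L v))
    (hup : ∀ v, cd.inner (L v) (L v) ≤ C * ‖v‖ ^ 2) :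
    ∃ (E : Type v) (_ : NormedAddCommGroup E) (_ : InnerProductSpace ℝ E) (_ : CompleteSpace E)
      (J : V ≃L[ℝ] E), ∀ v w, inner ℝ (J v) (J w) = cd.inner (L v) (L w) := by
  let _ : NormedAddCommGroup F := cd.toNormedAddCommGroup
  let _ : InnerProductSpace ℝ F := InnerProductSpace.ofCore cd.toCore
  have hsq (v : V) : ‖L v‖ ^ 2 = cd.inner (L v) (L v) :=
    (real_inner_self_eq_norm_sq (L v)).symm
  let J : V ≃L[ℝ] F := L.toContinuousLinearEquivOfBounds (Real.sqrt C) (Real.sqrt c⁻¹)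
    (fun v => by
      have := Real.sqrt_le_sqrt ((hsq v).trans_le (hup v))
      rwa [Real.sqrt_sq (norm_nonneg _), Real.sqrt_mul' _ (sq_nonneg _),
        Real.sqrt_sq (norm_nonneg _)] at this)
    (fun x => by
      have h := (hlow (L.symm x)).trans_eq (hsq _).symm
      rw [L.apply_symm_apply, ← le_div_iff₀' hc, div_eq_inv_mul] at h
      have := Real.sqrt_le_sqrt h
      rwa [Real.sqrt_sq (norm_nonneg _), Real.sqrt_mul' _ (sq_nonneg _),
        Real.sqrt_sq (norm_nonneg _)] at this)
  have hcomplete : CompleteSpace F :=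
    (completeSpace_congr (e := J.toEquiv) J.isUniformEmbedding).1 inferInstance
  exact ⟨F, inferInstance, inferInstance, hcomplete, J, fun v w => rfl⟩

theorem IsCoercive.exists_continuousLinearEquiv_inner.{u} {V : Type u} [NormedAddCommGroup V]
    [InnerProductSpace ℝ V] [CompleteSpace V] {a : V →L[ℝ] V →L[ℝ] ℝ} (ha : IsCoercive a)
    (hsymm : ∀ v w, a v w = a w v) :
    ∃ (E : Type u) (_ : NormedAddCommGroup E) (_ : InnerProductSpace ℝ E) (_ : CompleteSpace E)
      (J : V ≃L[ℝ] E), ∀ v w, inner ℝ (J v) (J w) = a v w := by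
  obtain ⟨c, hc, hlow⟩ := ha
  let cd : InnerProductSpace.Core ℝ V :=
    { inner := fun v w => a v w
      conj_inner_symm := fun v w => hsymm w v
      re_inner_nonneg := fun v => le_trans (by positivity) (hlow v)
      add_left := fun v w z => by simp
      smul_left := fun v w r => by simp
      definite := fun v hv => by
        have h := (hlow v).trans_eq hv
        by_contra hne
        have : 0 < c * ‖v‖ * ‖v‖ := by positivity
        linarith }
  have hup (v : V) : a v v ≤ ‖a‖ * ‖v‖ ^ 2 := by
    have := (le_abs_self _).trans (a.le_opNorm₂ v v)
    linarith
  -- Here `F` is `V` as a bare vector space, so the energy norm does not compete with the original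
  -- norm.
  exact cd.exists_continuousLinearEquiv (LinearEquiv.refl ℝ V) hc
    (fun v => (by linarith [hlow v] : c * ‖v‖ ^ 2 ≤ a v v)) hup

theorem ContinuousLinearEquiv.submodule_map_top {V E : Type*} [NormedAddCommGroup V]
    [NormedSpace ℝ V] [NormedAddCommGroup E] [NormedSpace ℝ E] (J : V ≃L[ℝ] E) :
    (⊤ : Submodule ℝ V).map (J : V →ₗ[ℝ] E) = ⊤ := by
  rw [Submodule.map_top, LinearMap.range_eq_top]
  exact J.surjective

end Renorming

/-! ### Translation of the variational problem into the energy space -/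

namespace VariationalEigenproblem

section General

universe u

variable {V : Type u} {W : Type*}
  [NormedAddCommGroup V] [InnerProductSpace ℝ V] [CompleteSpace V]
  [NormedAddCommGroup W] [InnerProductSpace ℝ W]
  (P : VariationalEigenproblem V W)

theorem continuous_solOp : Continuous P.solOp := by
  have : Continuous fun f : W => (P.b f).comp P.emb :=
    P.b.continuous.clm_comp continuous_const
  exact P.a_coercive.continuousLinearEquivOfBilin.symm.continuous.comp
    ((InnerProductSpace.toDual ℝ V).symm.continuous.comp this)

/-- The solution operator as a linear map. -/
noncomputable def solOpLM : W →ₗ[ℝ] V where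
  toFun := P.solOp
  map_add' f g := by simp [solOp, ContinuousLinearMap.add_comp]
  map_smul' c f := by simp [solOp]

theorem bV_symm (v w : V) : P.bV v w = P.bV w v := P.b_symm _ _

theorem bV_pos {v : V} (hv : v ≠ 0) : 0 < P.bV v v :=
  P.b_pos _ fun h => hv (P.emb_injective (h.trans (map_zero _).symm))

/-- The energy space with its compact operator: `V` renormed so that `a` is the inner product,
and the operator that represents `b`. -/
theorem exists_energySpace :
    ∃ (E : Type u) (_ : NormedAddCommGroup E) (_ : InnerProductSpace ℝ E) (_ : CompleteSpace E)
      (J : V ≃L[ℝ] E) (K : E →L[ℝ] E), (∀ v w, inner ℝ (J v) (J w) = P.a v w) ∧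
        IsCompactOperator K ∧ ∀ f, K (J f) = J (P.solOp (P.emb f)) := by
  obtain ⟨E, i₁, i₂, i₃, J, hJ⟩ := P.a_coercive.exists_continuousLinearEquiv_inner P.a_symm
  refine ⟨E, i₁, i₂, i₃, J, ⟨J.toLinearEquiv.toLinearMap ∘ₗ P.solOpLM ∘ₗ P.emb.toLinearMap ∘ₗ
    J.symm.toLinearEquiv.toLinearMap, ?_⟩, hJ, ?_, fun f => ?_⟩
  · exact J.continuous.comp (P.continuous_solOp.comp (P.emb.continuous.comp J.symm.continuous))
  · exact (P.emb_compact.comp_clm (J.symm : E →L[ℝ] V)).continuous_comp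
      (J.continuous.comp P.continuous_solOp)
  · change J (P.solOp (P.emb (J.symm (J f)))) = _
    rw [J.symm_apply_apply]

end General

section Transfer

variable {V W E : Type*}
  [NormedAddCommGroup V] [InnerProductSpace ℝ V] [CompleteSpace V]
  [NormedAddCommGroup W] [InnerProductSpace ℝ W]
  [NormedAddCommGroup E] [InnerProductSpace ℝ E]
  {P : VariationalEigenproblem V W} {J : V ≃L[ℝ] E} {K : E →L[ℝ] E}

theorem inner_map_of_energySpace (hJ : ∀ v w, inner ℝ (J v) (J w) = P.a v w)
    (hK : ∀ f, K (J f) = J (P.solOp (P.emb f))) (v w : V) :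
    inner ℝ (K (J v)) (J w) = P.bV v w := by
  rw [hK, hJ, solOp_spec, bV]

theorem isSymmetric_of_energySpace (hJ : ∀ v w, inner ℝ (J v) (J w) = P.a v w)
    (hK : ∀ f, K (J f) = J (P.solOp (P.emb f))) : K.IsSymmetric := by
  intro x y
  obtain ⟨v, rfl⟩ := J.surjective x
  obtain ⟨w, rfl⟩ := J.surjective y
  rw [ContinuousLinearMap.coe_coe, inner_map_of_energySpace hJ hK, real_inner_comm,
    inner_map_of_energySpace hJ hK, bV_symm]

theorem energyNorm_eq_norm (hJ : ∀ v w, inner ℝ (J v) (J w) = P.a v w) (v : V) :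
    P.energyNorm v = ‖J v‖ := by
  rw [energyNorm, ← hJ, real_inner_self_eq_norm_sq, Real.sqrt_sq (norm_nonneg _)]

/-- Cauchy–Schwarz, with equality at the `v` for which `J v = K (J w)`. -/
theorem negNorm_eq_norm (hJ : ∀ v w, inner ℝ (J v) (J w) = P.a v w)
    (hK : ∀ f, K (J f) = J (P.solOp (P.emb f))) (w : V) :
    P.negNorm w = ‖K (J w)‖ := by
  have hle (v : V) : P.bV w v / P.energyNorm v ≤ ‖K (J w)‖ := by
    rw [energyNorm_eq_norm hJ, ← inner_map_of_energySpace hJ hK]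
    exact div_le_of_le_mul₀ (norm_nonneg _) (norm_nonneg _) (real_inner_le_norm _ _)
  rw [negNorm]
  -- In this case there is no nonzero maximizer, and for trivial `V` the supremum is over the empty
  -- set, with value `0`.
  by_cases h0 : K (J w) = 0
  · apply le_antisymm
    · refine Real.sSup_le ?_ (norm_nonneg _)
      rintro _ ⟨v, _, rfl⟩
      exact hle v
    · rw [h0, norm_zero]
      refine Real.sSup_nonneg ?_
      rintro _ ⟨v, _, rfl⟩
      change 0 ≤ P.bV w v / P.energyNorm v
      rw [← inner_map_of_energySpace hJ hK, h0, inner_zero_left, zero_div]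
  · obtain ⟨z, hz⟩ := J.surjective (K (J w))
    refine IsGreatest.csSup_eq ⟨⟨z, ?_, ?_⟩, ?_⟩
    · rintro rfl
      exact h0 (by rw [← hz, map_zero])
    · change P.bV w z / P.energyNorm z = _
      rw [energyNorm_eq_norm hJ, ← inner_map_of_energySpace hJ hK, hz,
        real_inner_self_eq_norm_mul_norm, mul_div_cancel_right₀ _ (norm_ne_zero_iff.2 h0)]
    · rintro _ ⟨v, _, rfl⟩
      exact hle v

theorem bestApprox_eq_norm (hJ : ∀ v w, inner ℝ (J v) (J w) = P.a v w) (S : Submodule ℝ V)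
    [(S.map (J : V →ₗ[ℝ] E)).HasOrthogonalProjection] (w : V) :
    P.bestApprox S w = ‖J w - (S.map (J : V →ₗ[ℝ] E)).starProjection (J w)‖ := by
  refine IsLeast.csInf_eq ⟨?_, ?_⟩
  · obtain ⟨s, hs, hs'⟩ := Submodule.mem_map.1
      (Submodule.starProjection_apply_mem (S.map (J : V →ₗ[ℝ] E)) (J w))
    refine ⟨s, hs, ?_⟩
    change P.energyNorm (w - s) = _
    rw [energyNorm_eq_norm hJ, map_sub, ← hs']
    rfl
  · rintro _ ⟨s, hs, rfl⟩
    change _ ≤ P.energyNorm (w - s)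
    rw [energyNorm_eq_norm hJ, map_sub]
    exact norm_sub_starProjection_le_norm_sub _ (Submodule.mem_map_of_mem hs)

theorem eta_nonneg (hJ : ∀ v w, inner ℝ (J v) (J w) = P.a v w) (S : Submodule ℝ V)
    [(S.map (J : V →ₗ[ℝ] E)).HasOrthogonalProjection] : 0 ≤ P.eta S := by
  refine Real.sSup_nonneg ?_
  rintro _ ⟨f, _, rfl⟩
  change 0 ≤ P.bestApprox S _
  rw [bestApprox_eq_norm hJ]
  exact norm_nonneg _

theorem norm_map_sub_starProjection_le_eta (hJ : ∀ v w, inner ℝ (J v) (J w) = P.a v w)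
    (hK : ∀ f, K (J f) = J (P.solOp (P.emb f))) (S : Submodule ℝ V)
    [(S.map (J : V →ₗ[ℝ] E)).HasOrthogonalProjection] (x : E) :
    ‖K x - (S.map (J : V →ₗ[ℝ] E)).starProjection (K x)‖ ≤ P.eta S * ‖x‖ := by
  have hbest (f : V) : P.bestApprox S (P.solOp (P.emb f)) =
      ‖K (J f) - (S.map (J : V →ₗ[ℝ] E)).starProjection (K (J f))‖ := by
    rw [bestApprox_eq_norm hJ, hK]
  -- Without boundedness `sSup` would be the default `0` and carry no information.
  have hbdd : BddAbove ((fun f : V => P.bestApprox S (P.solOp (P.emb f))) ''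
      {f : V | P.energyNorm f = 1}) := by
    refine ⟨‖K‖, ?_⟩
    rintro _ ⟨f, hf, rfl⟩
    change P.bestApprox S _ ≤ _
    rw [hbest]
    refine (norm_sub_starProjection_le_norm _).trans ((K.le_opNorm _).trans ?_)
    rw [← energyNorm_eq_norm hJ, show P.energyNorm f = 1 from hf, mul_one]
  obtain ⟨f, rfl⟩ := J.surjective x
  rcases eq_or_ne f 0 with rfl | hf
  · simp
  have hpos : 0 < ‖J f‖ := norm_pos_iff.2 fun h => hf (J.injective (h.trans (map_zero J).symm))
  have hmem : P.energyNorm (‖J f‖⁻¹ • f) = 1 := by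
    rw [energyNorm_eq_norm hJ, map_smul, norm_smul, norm_inv, norm_norm, inv_mul_cancel₀ hpos.ne']
  have h := le_csSup hbdd ⟨_, hmem, rfl⟩
  change P.bestApprox S _ ≤ P.eta S at h
  rw [hbest, map_smul, map_smul, map_smul, ← smul_sub, norm_smul, norm_inv, norm_norm,
    inv_mul_le_iff₀ hpos] at h
  linarith

theorem delta_nonneg (hJ : ∀ v w, inner ℝ (J v) (J w) = P.a v w) (S : Submodule ℝ V)
    [(S.map (J : V →ₗ[ℝ] E)).HasOrthogonalProjection] (lam : ℝ) : 0 ≤ P.delta S lam := by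
  refine Real.sSup_nonneg ?_
  rintro _ ⟨f, _, rfl⟩
  rw [bestApprox_eq_norm hJ]
  exact norm_nonneg _

theorem norm_sub_starProjection_le_delta (hJ : ∀ v w, inner ℝ (J v) (J w) = P.a v w)
    (S : Submodule ℝ V) [(S.map (J : V →ₗ[ℝ] E)).HasOrthogonalProjection] {lam : ℝ} {u : V}
    (hu : P.IsEigenpair ⊤ lam u) :
    ‖J u - (S.map (J : V →ₗ[ℝ] E)).starProjection (J u)‖ ≤ P.delta S lam := by
  rw [← bestApprox_eq_norm hJ]
  -- All normalized eigenfunctions for `lam` have energy norm `√lam`, which bounds the set.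
  refine le_csSup ⟨Real.sqrt lam, ?_⟩ ⟨u, hu, rfl⟩
  rintro _ ⟨w, hw, rfl⟩
  rw [bestApprox_eq_norm hJ]
  refine (norm_sub_starProjection_le_norm _).trans (le_of_eq ?_)
  rw [← energyNorm_eq_norm hJ, energyNorm, hw.1.2 w Submodule.mem_top, hw.2, mul_one]

/-- The relation `a(w, v) = ν b(w, v)` on `S` says that `K (J w) - ν⁻¹ • J w` is orthogonal to the
image of `S`. -/
theorem mem_eigenspace_iff_starProjection (hJ : ∀ v w, inner ℝ (J v) (J w) = P.a v w)
    (hK : ∀ f, K (J f) = J (P.solOp (P.emb f))) {S : Submodule ℝ V}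
    [(S.map (J : V →ₗ[ℝ] E)).HasOrthogonalProjection] {ν : ℝ} (hν : ν ≠ 0) {w : V} :
    w ∈ P.eigenspace S ν ↔
      J w ∈ Module.End.eigenspace (galerkinOp K (S.map (J : V →ₗ[ℝ] E)) : End ℝ E) ν⁻¹ := by
  rw [mem_eigenspace_galerkinOp (inv_ne_zero hν)]
  have hmem : J w ∈ S.map (J : V →ₗ[ℝ] E) ↔ w ∈ S := by
    constructor
    · rintro ⟨s, hs, h⟩
      rwa [← J.injective h]
    · exact fun h => Submodule.mem_map_of_mem h
  rw [hmem]
  refine and_congr_right fun hw => ⟨fun h => ?_, fun h v hv => ?_⟩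
  · refine Submodule.eq_starProjection_of_mem_of_inner_eq_zero
      (Submodule.smul_mem _ _ (hmem.2 hw)) ?_
    rintro _ ⟨s, hs, rfl⟩
    change inner ℝ (K (J w) - ν⁻¹ • J w) (J s) = 0
    rw [inner_sub_left, real_inner_smul_left, inner_map_of_energySpace hJ hK, hJ, h s hs,
      inv_mul_cancel_left₀ hν, sub_self]
  · have h1 := Submodule.starProjection_inner_eq_zero (K := S.map (J : V →ₗ[ℝ] E)) (K (J w)) (J v)
      (Submodule.mem_map_of_mem hv)
    rw [h, inner_sub_left, real_inner_smul_left, inner_map_of_energySpace hJ hK, hJ,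
      sub_eq_zero] at h1
    rw [h1, mul_inv_cancel_left₀ hν]

end Transfer

section Eigenspaces

variable {V W : Type*}
  [NormedAddCommGroup V] [InnerProductSpace ℝ V] [CompleteSpace V]
  [NormedAddCommGroup W] [InnerProductSpace ℝ W]
  {P : VariationalEigenproblem V W}

theorem eigenspace_le (S : Submodule ℝ V) (ν : ℝ) : P.eigenspace S ν ≤ S := fun _ h => h.1

theorem a_self_pos {v : V} (hv : v ≠ 0) : 0 < P.a v v := by
  obtain ⟨c, hc, h⟩ := P.a_coercive
  exact lt_of_lt_of_le (by positivity) (h v)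

theorem pos_of_eigenspace_ne_bot {S : Submodule ℝ V} {ν : ℝ} (h : P.eigenspace S ν ≠ ⊥) :
    0 < ν := by
  obtain ⟨w, hw, hw0⟩ := (Submodule.ne_bot_iff _).1 h
  have h1 := a_self_pos (P := P) hw0
  rw [hw.2 w hw.1] at h1
  exact pos_of_mul_pos_left h1 (P.bV_pos hw0).le

theorem eigenspace_eq_bot_of_nonpos {S : Submodule ℝ V} {ν : ℝ} (h : ν ≤ 0) :
    P.eigenspace S ν = ⊥ :=
  not_not.1 fun h' => (pos_of_eigenspace_ne_bot h').not_ge h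

theorem IsIthEigenvalue.pos {S : Submodule ℝ V} {i : ℕ} {ν : ℝ} (h : P.IsIthEigenvalue S i ν) :
    0 < ν := by
  by_contra! hν
  have : (⨆ κ : Set.Iic ν, P.eigenspace S κ) = ⊥ :=
    iSup_eq_bot.2 fun κ => eigenspace_eq_bot_of_nonpos (le_trans κ.2 hν)
  have h1 := h.1
  have h2 := h.2
  rw [this, finrank_bot] at h2
  omega

end Eigenspaces

/-! ### Counting eigenvalues and comparing them across Galerkin spaces -/

section Counting

variable {V W E : Type*}
  [NormedAddCommGroup V] [InnerProductSpace ℝ V] [CompleteSpace V]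
  [NormedAddCommGroup W] [InnerProductSpace ℝ W]
  [NormedAddCommGroup E] [InnerProductSpace ℝ E]
  {P : VariationalEigenproblem V W} {J : V ≃L[ℝ] E} {K : E →L[ℝ] E}

/-- Nonpositive levels in `I` contribute nothing, so inversion need only match the positive ones. -/
theorem map_iSup_eigenspace (hJ : ∀ v w, inner ℝ (J v) (J w) = P.a v w)
    (hK : ∀ f, K (J f) = J (P.solOp (P.emb f))) (S : Submodule ℝ V)
    [(S.map (J : V →ₗ[ℝ] E)).HasOrthogonalProjection] {I I' : Set ℝ}
    (hI : ∀ κ, κ ∈ I' ↔ 0 < κ ∧ κ⁻¹ ∈ I) :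
    (⨆ ν : I, P.eigenspace S ν).map (J : V →ₗ[ℝ] E) =
      ⨆ κ : I', Module.End.eigenspace (galerkinOp K (S.map (J : V →ₗ[ℝ] E)) : End ℝ E) κ := by
  apply le_antisymm
  · rw [Submodule.map_iSup]
    refine iSup_le fun ν => ?_
    rcases le_or_gt (ν : ℝ) 0 with h | h
    · simp [eigenspace_eq_bot_of_nonpos h]
    · have hmem : (ν : ℝ)⁻¹ ∈ I' := (hI _).2 ⟨inv_pos.2 h, by simp⟩
      rintro _ ⟨w, hw, rfl⟩
      exact Submodule.mem_iSup_of_mem (⟨_, hmem⟩ : I')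
        ((mem_eigenspace_iff_starProjection hJ hK h.ne').1 hw)
  · refine iSup_le fun κ x hx => ?_
    obtain ⟨h0, hκ⟩ := (hI κ).1 κ.2
    obtain ⟨w, rfl⟩ := J.surjective x
    refine Submodule.mem_map_of_mem (Submodule.mem_iSup_of_mem (⟨_, hκ⟩ : I) ?_)
    rw [mem_eigenspace_iff_starProjection hJ hK (inv_ne_zero h0.ne'), inv_inv]
    exact hx

theorem finrank_iSup_eigenspace (hJ : ∀ v w, inner ℝ (J v) (J w) = P.a v w)
    (hK : ∀ f, K (J f) = J (P.solOp (P.emb f))) (S : Submodule ℝ V)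
    [(S.map (J : V →ₗ[ℝ] E)).HasOrthogonalProjection] {I I' : Set ℝ}
    (hI : ∀ κ, κ ∈ I' ↔ 0 < κ ∧ κ⁻¹ ∈ I) :
    finrank ℝ (⨆ κ : I', Module.End.eigenspace
        (galerkinOp K (S.map (J : V →ₗ[ℝ] E)) : End ℝ E) κ : Submodule ℝ E) =
      finrank ℝ (⨆ ν : I, P.eigenspace S ν : Submodule ℝ V) := by
  rw [← map_iSup_eigenspace hJ hK S hI]
  exact LinearEquiv.finrank_map_eq J.toLinearEquiv _

/-- The counting functions of a Galerkin eigenvalue problem in terms of the compact operator. -/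
theorem IsIthEigenvalue.finrank_lt_and_le (hJ : ∀ v w, inner ℝ (J v) (J w) = P.a v w)
    (hK : ∀ f, K (J f) = J (P.solOp (P.emb f))) {S : Submodule ℝ V}
    [(S.map (J : V →ₗ[ℝ] E)).HasOrthogonalProjection] {i : ℕ} {ν : ℝ}
    (h : P.IsIthEigenvalue S i ν) :
    finrank ℝ (⨆ κ : Set.Ioi ν⁻¹, Module.End.eigenspace
        (galerkinOp K (S.map (J : V →ₗ[ℝ] E)) : End ℝ E) κ : Submodule ℝ E) < i ∧
      i ≤ finrank ℝ (⨆ κ : Set.Ici ν⁻¹, Module.End.eigenspace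
        (galerkinOp K (S.map (J : V →ₗ[ℝ] E)) : End ℝ E) κ : Submodule ℝ E) := by
  have hν := h.pos
  rw [finrank_iSup_eigenspace hJ hK S (I := Set.Iio ν) fun κ => ?_,
    finrank_iSup_eigenspace hJ hK S (I := Set.Iic ν) fun κ => ?_]
  · exact h
  · rw [Set.mem_Ici, Set.mem_Iic]
    exact ⟨fun hκ => ⟨(inv_pos.2 hν).trans_le hκ, inv_le_of_inv_le₀ hν hκ⟩,
      fun hκ => inv_le_of_inv_le₀ hκ.1 hκ.2⟩
  · rw [Set.mem_Ioi, Set.mem_Iio]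
    exact ⟨fun hκ => ⟨(inv_pos.2 hν).trans hκ, inv_lt_of_inv_lt₀ hν hκ⟩,
      fun hκ => inv_lt_of_inv_lt₀ hκ.1 hκ.2⟩

/-- Eigenvalues with the same number of two Galerkin problems are close if the operators are. -/
theorem IsIthEigenvalue.inv_le_inv_add [CompleteSpace E]
    (hJ : ∀ v w, inner ℝ (J v) (J w) = P.a v w)
    (hK : ∀ f, K (J f) = J (P.solOp (P.emb f))) (hc : IsCompactOperator K) {S S' : Submodule ℝ V}
    [(S.map (J : V →ₗ[ℝ] E)).HasOrthogonalProjection]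
    [(S'.map (J : V →ₗ[ℝ] E)).HasOrthogonalProjection] {i : ℕ} {ν ν' c : ℝ}
    (h : P.IsIthEigenvalue S i ν) (h' : P.IsIthEigenvalue S' i ν')
    (hSS' : ∀ x, ‖galerkinOp K (S.map (J : V →ₗ[ℝ] E)) x -
      galerkinOp K (S'.map (J : V →ₗ[ℝ] E)) x‖ ≤ c * ‖x‖) :
    ν⁻¹ ≤ ν'⁻¹ + c := by
  have h1 := h.finrank_lt_and_le hJ hK
  have h2 := h'.finrank_lt_and_le hJ hK
  have hs := isSymmetric_of_energySpace hJ hK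
  have hfin : FiniteDimensional ℝ (⨆ κ : Set.Ici ν'⁻¹, Module.End.eigenspace
      (galerkinOp K (S'.map (J : V →ₗ[ℝ] E)) : End ℝ E) κ : Submodule ℝ E) :=
    FiniteDimensional.of_finrank_pos (by omega)
  have hfin' : FiniteDimensional ℝ (⨆ κ : Set.Ioi ν'⁻¹, Module.End.eigenspace
      (galerkinOp K (S'.map (J : V →ₗ[ℝ] E)) : End ℝ E) κ : Submodule ℝ E) := by
    refine Submodule.finiteDimensional_of_le (iSup_le fun κ => ?_) (S₂ := ⨆ κ : Set.Ici ν'⁻¹,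
      Module.End.eigenspace (galerkinOp K (S'.map (J : V →ₗ[ℝ] E)) : End ℝ E) κ)
    exact le_iSup (fun κ : Set.Ici ν'⁻¹ =>
      Module.End.eigenspace (galerkinOp K (S'.map (J : V →ₗ[ℝ] E)) : End ℝ E) (κ : ℝ))
      ⟨κ, Set.mem_Ici.2 (le_of_lt κ.2)⟩
  exact ContinuousLinearMap.le_add_of_finrank_iSup_eigenspace_lt (isCompactOperator_galerkinOp hc)
    (isSymmetric_galerkinOp hs) (isSymmetric_galerkinOp hs) hSS' (h2.1.trans_le h1.2)

/-- A Galerkin space that resolves the operator well has at least as many dimensions as there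
are eigenvalues to approximate. -/
theorem IsIthEigenvalue.le_finrank (hJ : ∀ v w, inner ℝ (J v) (J w) = P.a v w)
    (hK : ∀ f, K (J f) = J (P.solOp (P.emb f)))
    [((⊤ : Submodule ℝ V).map (J : V →ₗ[ℝ] E)).HasOrthogonalProjection]
    {i : ℕ} {ν : ℝ} (h : P.IsIthEigenvalue ⊤ i ν) (S : Submodule ℝ V) [FiniteDimensional ℝ S]
    {c : ℝ} (hc : c < ν⁻¹)
    (hS : ∀ x, ‖K x - galerkinOp K (S.map (J : V →ₗ[ℝ] E)) x‖ ≤ c * ‖x‖) :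
    i ≤ finrank ℝ S := by
  have h1 := (h.finrank_lt_and_le hJ hK).2
  rw [galerkinOp_eq_self (J.submodule_map_top)] at h1
  by_contra! hlt
  have hrank : finrank ℝ (S.map (J : V →ₗ[ℝ] E)) = finrank ℝ S :=
    LinearEquiv.finrank_map_eq J.toLinearEquiv S
  -- If `S` were too small, some `x` in the span of exact eigenfunctions with eigenvalue at most `ν`
  -- would be killed by the compression, although `(K x, x) ≥ ν⁻¹ ‖x‖²`.
  obtain ⟨x, hx, hxS, hx0⟩ := Submodule.exists_mem_orthogonal_of_finrank_lt
    ((hrank.trans_lt hlt).trans_le h1)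
  have h2 := LinearMap.IsSymmetric.le_inner_map_self_of_mem_iSup
    (isSymmetric_of_energySpace hJ hK) (fun _ hν => hν) hx
  have h3 : galerkinOp K (S.map (J : V →ₗ[ℝ] E)) x = 0 := by
    rw [galerkinOp_apply, (Submodule.starProjection_apply_eq_zero_iff _).2 hxS, map_zero, map_zero]
  have h4 := hS x
  rw [h3, sub_zero] at h4
  have h5 : inner ℝ (K x) x ≤ c * ‖x‖ * ‖x‖ :=
    (real_inner_le_norm _ _).trans (mul_le_mul_of_nonneg_right h4 (norm_nonneg _))
  have h6 : 0 < ‖x‖ ^ 2 := by positivity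
  have h7 := mul_lt_mul_of_pos_right hc h6
  change ν⁻¹ * ‖x‖ ^ 2 ≤ inner ℝ (K x) x at h2
  linarith

/-- A nonzero vector of `S` orthogonal to all Galerkin eigenvectors would have `b(v, v) ≤ 0`. -/
theorem finrank_le_finrank_iSup_eigenspace [CompleteSpace E]
    (hJ : ∀ v w, inner ℝ (J v) (J w) = P.a v w)
    (hK : ∀ f, K (J f) = J (P.solOp (P.emb f))) (hc : IsCompactOperator K)
    (S : Submodule ℝ V) [FiniteDimensional ℝ S] :
    finrank ℝ S ≤ finrank ℝ (⨆ ν, P.eigenspace S ν : Submodule ℝ V) := by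
  have hs := isSymmetric_of_energySpace hJ hK
  have heq := map_iSup_eigenspace hJ hK S (I := Set.univ) (I' := Set.Ioi 0) (by simp)
  have huniv : (⨆ ν : (Set.univ : Set ℝ), P.eigenspace S ν) = ⨆ ν, P.eigenspace S ν :=
    (Equiv.Set.univ ℝ).iSup_comp (g := fun ν => P.eigenspace S ν)
  rw [huniv] at heq
  have hle : (⨆ ν, P.eigenspace S ν) ≤ S := iSup_le fun ν => eigenspace_le S ν
  have hfin : FiniteDimensional ℝ (⨆ ν, P.eigenspace S ν : Submodule ℝ V) :=
    Submodule.finiteDimensional_of_le hle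
  by_contra! hlt
  rw [← LinearEquiv.finrank_map_eq J.toLinearEquiv S,
    ← LinearEquiv.finrank_map_eq J.toLinearEquiv (⨆ ν, P.eigenspace S ν)] at hlt
  have hfin' : FiniteDimensional ℝ
    ((⨆ ν, P.eigenspace S ν).map (J.toLinearEquiv : V →ₗ[ℝ] E)) := inferInstance
  obtain ⟨x, hx, hxY, hx0⟩ := Submodule.exists_mem_orthogonal_of_finrank_lt hlt
  change x ∈ ((⨆ ν, P.eigenspace S ν).map (J : V →ₗ[ℝ] E))ᗮ at hxY
  change x ∈ S.map (J : V →ₗ[ℝ] E) at hx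
  rw [heq] at hxY
  have h1 := ContinuousLinearMap.inner_map_self_le_of_mem_orthogonal
    (isCompactOperator_galerkinOp hc) (isSymmetric_galerkinOp hs) hxY
  rw [galerkinOp_apply_of_mem hx, Submodule.inner_starProjection_left_eq_right,
    Submodule.starProjection_eq_self_iff.2 hx, zero_mul] at h1
  obtain ⟨v, rfl⟩ := J.surjective x
  rw [inner_map_of_energySpace hJ hK] at h1
  exact (P.bV_pos fun hv : v = 0 => hx0 (by rw [hv, map_zero])).not_ge h1

theorem finite_eigenspace_ne_bot (hJ : ∀ v w, inner ℝ (J v) (J w) = P.a v w)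
    (hK : ∀ f, K (J f) = J (P.solOp (P.emb f))) (S : Submodule ℝ V) [FiniteDimensional ℝ S] :
    {ν | P.eigenspace S ν ≠ ⊥}.Finite := by
  set S' := S.map (J : V →ₗ[ℝ] E)
  let R : End ℝ S' := (galerkinOp K S' : End ℝ E).restrict
    (fun x _ => Submodule.starProjection_apply_mem S' _ : ∀ x ∈ S', galerkinOp K S' x ∈ S')
  refine Set.Finite.subset ((Module.End.finite_hasEigenvalue R).preimage
    (inv_injective.injOn (s := _))) fun ν hν => ?_
  have hpos := pos_of_eigenspace_ne_bot hν
  obtain ⟨w, hw, hw0⟩ := (Submodule.ne_bot_iff _).1 hν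
  have h := mem_eigenspace_iff.1 ((mem_eigenspace_iff_starProjection hJ hK hpos.ne').1 hw)
  refine hasEigenvalue_of_hasEigenvector
    (x := ⟨J w, Submodule.mem_map_of_mem hw.1⟩) ⟨mem_eigenspace_iff.2 (Subtype.ext h), ?_⟩
  intro h0
  exact hw0 (J.injective ((congrArg Subtype.val h0).trans (map_zero J).symm))

end Counting

/-! ### Existence of the `i`-th Galerkin eigenpair -/

/-- Among finitely many eigenspaces, there is a level at which their accumulated dimension
reaches a given positive number. -/
theorem exists_finrank_iSup_lt_and_le {V : Type*} [AddCommGroup V] [Module ℝ V]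
    {f : ℝ → Submodule ℝ V} (hf : {ν | f ν ≠ ⊥}.Finite)
    [FiniteDimensional ℝ (⨆ ν, f ν : Submodule ℝ V)] {i : ℕ} (hi0 : 0 < i)
    (hi : i ≤ finrank ℝ (⨆ ν, f ν : Submodule ℝ V)) :
    ∃ m, f m ≠ ⊥ ∧ finrank ℝ (⨆ ν : Set.Iio m, f ν : Submodule ℝ V) < i ∧
      i ≤ finrank ℝ (⨆ ν : Set.Iic m, f ν : Submodule ℝ V) := by
  have hfin (I : Set ℝ) : FiniteDimensional ℝ (⨆ ν : I, f ν : Submodule ℝ V) :=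
    Submodule.finiteDimensional_of_le (iSup_le fun ν => le_iSup f ν)
  have hstep {X : Submodule ℝ V} {I : Set ℝ} (hX : X = ⨆ ν : I, f ν) (hiX : i ≤ finrank ℝ X) :
      ∃ m ∈ I, f m ≠ ⊥ ∧ i ≤ finrank ℝ (⨆ ν : Set.Iic m, f ν : Submodule ℝ V) := by
    have hne : ({ν | f ν ≠ ⊥} ∩ I).Nonempty := by
      by_contra hemp
      have : X = ⊥ := by
        rw [hX, iSup_eq_bot]
        intro ν
        by_contra h
        exact hemp ⟨ν, h, ν.2⟩
      rw [this, finrank_bot] at hiX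
      omega
    obtain ⟨m, ⟨hm, hmI⟩, hmax⟩ := Set.exists_max_image _ id (hf.inter_of_left I) hne
    refine ⟨m, hmI, hm, hiX.trans (Submodule.finrank_mono ?_)⟩
    rw [hX]
    refine iSup_le fun ν => ?_
    by_cases h : f ν = ⊥
    · simp [h]
    · exact le_iSup (fun ν : Set.Iic m => f ν) ⟨ν, hmax ν ⟨h, ν.2⟩⟩
  obtain ⟨m₀, -, hm₀⟩ := hstep ((Equiv.Set.univ ℝ).iSup_comp (g := f)).symm hi
  -- The least such level works: if the levels below `m` already sufficed, `hstep` would produce a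
  -- smaller one.
  obtain ⟨m, ⟨hm, him⟩, hmin⟩ := Set.exists_min_image
    {m | f m ≠ ⊥ ∧ i ≤ finrank ℝ (⨆ ν : Set.Iic m, f ν : Submodule ℝ V)} id
    (hf.subset fun m h => h.1) ⟨m₀, hm₀⟩
  refine ⟨m, hm, ?_, him⟩
  by_contra! h
  obtain ⟨m', hm', h'⟩ := hstep rfl h
  exact absurd (hmin m' h') (not_le.2 hm')

section Main

variable {V W : Type*}
  [NormedAddCommGroup V] [InnerProductSpace ℝ V] [CompleteSpace V]
  [NormedAddCommGroup W] [InnerProductSpace ℝ W]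
  {P : VariationalEigenproblem V W}

theorem exists_isIthEigenvalue_isEigenpair (P : VariationalEigenproblem V W) (S : Submodule ℝ V)
    [FiniteDimensional ℝ S] {i : ℕ} (hi0 : 0 < i) (hi : i ≤ finrank ℝ S) (u : V) :
    ∃ (lam : ℝ) (w : V), P.IsIthEigenvalue S i lam ∧ P.IsEigenpair S lam w ∧ 0 ≤ P.bV u w := by
  obtain ⟨E, _, _, _, J, K, hJ, hc, hK⟩ := P.exists_energySpace
  have hfin : FiniteDimensional ℝ (⨆ ν, P.eigenspace S ν : Submodule ℝ V) :=
    Submodule.finiteDimensional_of_le (iSup_le fun ν => eigenspace_le S ν)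
  obtain ⟨m, hm, hlt, hle⟩ := exists_finrank_iSup_lt_and_le (finite_eigenspace_ne_bot hJ hK S) hi0
    (hi.trans (finrank_le_finrank_iSup_eigenspace hJ hK hc S))
  obtain ⟨w, hw, hw0⟩ := (Submodule.ne_bot_iff _).1 hm
  have hb := P.bV_pos hw0
  have hsmul (c d : ℝ) (v z : V) : P.bV (c • v) (d • z) = c * (d * P.bV v z) := by
    simp [bV, mul_left_comm]
  have hsmul' (d : ℝ) (v z : V) : P.bV v (d • z) = d * P.bV v z := by simp [bV]
  have hnorm : (Real.sqrt (P.bV w w))⁻¹ * ((Real.sqrt (P.bV w w))⁻¹ * P.bV w w) = 1 := by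
    have h := Real.mul_self_sqrt hb.le
    have h' : Real.sqrt (P.bV w w) ≠ 0 := (Real.sqrt_pos.2 hb).ne'
    field_simp
    linarith
  rcases le_total 0 (P.bV u w) with h | h
  · refine ⟨m, (Real.sqrt (P.bV w w))⁻¹ • w, ⟨hlt, hle⟩, ⟨Submodule.smul_mem _ _ hw, ?_⟩, ?_⟩
    · rw [hsmul, hnorm]
    · rw [hsmul']
      positivity
  · refine ⟨m, (-(Real.sqrt (P.bV w w))⁻¹) • w, ⟨hlt, hle⟩, ⟨Submodule.smul_mem _ _ hw, ?_⟩, ?_⟩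
    · rw [hsmul, ← hnorm]
      ring
    · rw [hsmul']
      exact mul_nonneg_of_nonpos_of_nonpos (by simp) h

end Main

end VariationalEigenproblem

/-! ### The source problem and the correction step -/

/-- The source problem improves the approximation of an eigenfunction, because the error of the
right-hand side enters in the negative norm. -/
theorem norm_sub_starProjection_smul_map_le {E : Type*} [NormedAddCommGroup E]
    [InnerProductSpace ℝ E] {K : E →L[ℝ] E} {μ lam : ℝ} {x : E}
    (hμ : 0 < μ) (hlam : lam = μ⁻¹) (hx : K x = μ • x) {S : Submodule ℝ E}
    [S.HasOrthogonalProjection] {C₀ lam₁ ε₁ η δ : ℝ} {y z : E}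
    (hC₀ : 0 ≤ C₀) (hη : 0 ≤ η) (hε₁ : 0 ≤ ε₁) (hε₁' : ε₁ ≤ 1)
    (hδ : ‖x - S.starProjection x‖ ≤ δ)
    (hy : ‖x - y‖ ≤ C₀ * ε₁) (hKy : ‖K (x - y)‖ ≤ C₀ * (η * ‖x - y‖))
    (hlam₁ : |lam - lam₁| ≤ C₀ * ε₁ ^ 2)
    (hz : z = S.starProjection (lam₁ • K y)) :
    ‖x - z‖ ≤ (1 + C₀ * ‖K x‖ + (lam + C₀) * (C₀ * C₀)) * (η * ε₁ + ε₁ ^ 2 + δ) := by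
  have hlam0 : 0 < lam := hlam ▸ inv_pos.2 hμ
  have hxeq : lam • K x = x := by rw [hx, smul_smul, hlam, inv_mul_cancel₀ hμ.ne', one_smul]
  -- Since `x = lam • K x`, the right-hand side error splits into an eigenvalue error and `K (x -
  -- y)`.
  have hsplit : x - z = (x - S.starProjection x) +
      S.starProjection ((lam - lam₁) • K x + lam₁ • K (x - y)) := by
    have : (lam - lam₁) • K x + lam₁ • K (x - y) = x - lam₁ • K y := by
      conv_rhs => rw [← hxeq]
      rw [map_sub]
      module
    rw [this, hz, map_sub]
    abel
  have hsq : ε₁ ^ 2 ≤ 1 := pow_le_one₀ hε₁ hε₁'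
  have h1 : ‖(lam - lam₁) • K x‖ ≤ C₀ * ε₁ ^ 2 * ‖K x‖ := by
    rw [norm_smul, Real.norm_eq_abs]
    gcongr
  have habs : |lam₁| ≤ lam + C₀ := by
    have h := abs_le.1 hlam₁
    have : C₀ * ε₁ ^ 2 ≤ C₀ := mul_le_of_le_one_right hC₀ hsq
    exact abs_le.2 ⟨by linarith, by linarith⟩
  have h2 : ‖lam₁ • K (x - y)‖ ≤ (lam + C₀) * (C₀ * (η * (C₀ * ε₁))) := by
    rw [norm_smul, Real.norm_eq_abs]
    refine mul_le_mul habs (hKy.trans ?_) (norm_nonneg _) (by positivity)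
    gcongr
  have h3 : ‖x - z‖ ≤ δ + (C₀ * ε₁ ^ 2 * ‖K x‖ + (lam + C₀) * (C₀ * (η * (C₀ * ε₁)))) := by
    rw [hsplit]
    refine (norm_add_le _ _).trans (add_le_add hδ ?_)
    exact (S.norm_starProjection_apply_le _).trans ((norm_add_le _ _).trans (add_le_add h1 h2))
  have hδ0 : 0 ≤ δ := (norm_nonneg _).trans hδ
  have r1 : 0 ≤ η * ε₁ + ε₁ ^ 2 := by positivity
  have r2 : 0 ≤ C₀ * ‖K x‖ * (η * ε₁ + δ) := by positivity
  have r3 : 0 ≤ (lam + C₀) * (C₀ * C₀) * (ε₁ ^ 2 + δ) := by positivity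
  linarith

namespace VariationalEigenproblem

section Correction

variable {V W E : Type*}
  [NormedAddCommGroup V] [InnerProductSpace ℝ V] [CompleteSpace V]
  [NormedAddCommGroup W] [InnerProductSpace ℝ W]
  [NormedAddCommGroup E] [InnerProductSpace ℝ E]
  {P : VariationalEigenproblem V W} {J : V ≃L[ℝ] E} {K : E →L[ℝ] E}

/-- The Galerkin solution of a source problem is the projection of the exact solution. -/
theorem forall_a_eq_iff_eq_starProjection (hJ : ∀ v w, inner ℝ (J v) (J w) = P.a v w)
    (hK : ∀ f, K (J f) = J (P.solOp (P.emb f))) {S : Submodule ℝ V}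
    [(S.map (J : V →ₗ[ℝ] E)).HasOrthogonalProjection] {t : ℝ} {f w : V} (hw : w ∈ S) :
    (∀ v ∈ S, P.a w v = t * P.bV f v) ↔
      J w = (S.map (J : V →ₗ[ℝ] E)).starProjection (t • K (J f)) := by
  have hb (v : V) : t * P.bV f v = inner ℝ (t • K (J f)) (J v) := by
    rw [real_inner_smul_left, inner_map_of_energySpace hJ hK]
  constructor
  · intro h
    refine (Submodule.eq_starProjection_of_mem_of_inner_eq_zero
      (Submodule.mem_map_of_mem hw) ?_).symm
    rintro _ ⟨s, hs, rfl⟩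
    change inner ℝ (t • K (J f) - J w) (J s) = 0
    rw [inner_sub_left, ← hb, hJ, h s hs, sub_self]
  · intro h v hv
    have h1 := Submodule.starProjection_inner_eq_zero (K := S.map (J : V →ₗ[ℝ] E))
      (t • K (J f)) (J v) (Submodule.mem_map_of_mem hv)
    rw [← h, inner_sub_left, ← hb, hJ, sub_eq_zero] at h1
    exact h1.symm

end Correction

end VariationalEigenproblem

open VariationalEigenproblem in
theorem mainTheorem4 {V W : Type*}
    [NormedAddCommGroup V] [InnerProductSpace ℝ V] [CompleteSpace V]
    [NormedAddCommGroup W] [InnerProductSpace ℝ W]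
    (P : VariationalEigenproblem V W)
    (i : ℕ) (lam : ℝ) (u : V)
    (hi : P.IsIthEigenvalue ⊤ i lam)
    (hsimple : Module.finrank ℝ (P.eigenspace ⊤ lam) = 1)
    (hu : P.IsEigenpair ⊤ lam u) :
    ∃ η₀ : ℝ, 0 < η₀ ∧ ∀ C₀ : ℝ, 0 < C₀ → ∃ C : ℝ, 0 < C ∧
      ∀ (VH V₁ V₂ : Submodule ℝ V),
        FiniteDimensional ℝ VH → FiniteDimensional ℝ V₁ → FiniteDimensional ℝ V₂ →
        VH ≤ V₂ → V₁ ≤ V₂ → P.eta VH ≤ η₀ →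
      ∀ (lam₁ : ℝ) (u₁ : V) (ε₁ ε₂ : ℝ), u₁ ∈ V₁ →
        P.energyNorm (u - u₁) ≤ C₀ * ε₁ →
        P.negNorm (u - u₁) ≤ C₀ * (P.eta VH * P.energyNorm (u - u₁)) →
        |lam - lam₁| ≤ C₀ * ε₁ ^ 2 →
        ε₂ = P.eta VH * ε₁ + ε₁ ^ 2 + P.delta V₂ lam →
        (∃ (lam₂ : ℝ) (u₂ : V), P.IsCorrection i VH lam₁ u₁ V₂ lam₂ u₂ ∧ 0 ≤ P.bV u u₂) ∧
        ∀ (lam₂ : ℝ) (u₂ : V), P.IsCorrection i VH lam₁ u₁ V₂ lam₂ u₂ → 0 ≤ P.bV u u₂ →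
          u₂ ∈ V₂ ∧
          P.energyNorm (u - u₂) ≤ C * ε₂ ∧
          P.negNorm (u - u₂) ≤ C * (P.eta VH * P.energyNorm (u - u₂)) ∧
          |lam - lam₂| ≤ C * ε₂ ^ 2 := by
  obtain ⟨E, _, _, _, J, K, hJ, hc, hK⟩ := P.exists_energySpace
  have hKs := isSymmetric_of_energySpace hJ hK
  have hlam : 0 < lam := hi.pos
  have hμ : 0 < lam⁻¹ := inv_pos.2 hlam
  have htop := J.submodule_map_top
  have hproj : ((⊤ : Submodule ℝ V).map (J : V →ₗ[ℝ] E)).HasOrthogonalProjection := by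
    rw [htop]; infer_instance
  have heig (w : V) : w ∈ P.eigenspace ⊤ lam ↔
      J w ∈ Module.End.eigenspace (K : End ℝ E) lam⁻¹ := by
    rw [mem_eigenspace_iff_starProjection hJ hK hlam.ne', galerkinOp_eq_self htop]
  have hu0 : u ≠ 0 := by
    rintro rfl
    simpa [bV] using hu.2
  have huK : K (J u) = lam⁻¹ • J u := mem_eigenspace_iff.1 ((heig u).1 hu.1)
  have hspan : Module.End.eigenspace (K : End ℝ E) lam⁻¹ ≤ Submodule.span ℝ {J u} := by
    intro x hx
    obtain ⟨w, rfl⟩ := J.surjective x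
    obtain ⟨c, hc⟩ := (finrank_eq_one_iff_of_nonzero' (⟨u, hu.1⟩ : P.eigenspace ⊤ lam)
      (fun h => hu0 (congrArg Subtype.val h))).1 hsimple ⟨w, (heig w).2 hx⟩
    refine Submodule.mem_span_singleton.2 ⟨c, ?_⟩
    rw [← map_smul]
    exact congrArg J (congrArg Subtype.val hc)
  obtain ⟨γ, hγ0, hγ⟩ := hc.exists_mul_norm_le_of_eigenspace_le hKs hμ.ne' huK hspan
  obtain ⟨A, hA, herr⟩ := galerkin_eigenpair_error hKs hμ huK
    (by rw [inner_map_of_energySpace hJ hK, hu.2]) hγ hγ0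
  -- The first bound preserves the spectral gap; the second gives `2 η < 1/lam`, needed for `dim S ≥
  -- i`, and keeps `1/lam₂` away from `0`.
  refine ⟨min (γ / 16) (lam⁻¹ / 4), by positivity, fun C₀ hC₀ => ?_⟩
  -- The summand `‖J u‖` covers the case `ε₁ ≥ 1`, the rest is the constant of the source problem.
  set D : ℝ := ‖J u‖ + (1 + C₀ * ‖K (J u)‖ + (lam + C₀) * (C₀ * C₀)) with hD
  have hD0 : 0 < D := by positivity
  refine ⟨A * D + A + A * (A * D) ^ 2, by positivity, ?_⟩
  intro VH V₁ V₂ _ _ _ hHV₂ _ hη lam₁ u₁ ε₁ ε₂ _ hu₁ hu₁neg hlam₁ hε₂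
  have hηγ := hη.trans (min_le_left _ _)
  have hημ := hη.trans (min_le_right _ _)
  have hη0 : 0 ≤ P.eta VH := eta_nonneg hJ VH
  have hδ := norm_sub_starProjection_le_delta hJ V₂ hu
  have hδ0 : 0 ≤ P.delta V₂ lam := delta_nonneg hJ V₂ lam
  rw [energyNorm_eq_norm hJ] at hu₁
  rw [negNorm_eq_norm hJ hK, energyNorm_eq_norm hJ] at hu₁neg
  rw [map_sub] at hu₁ hu₁neg
  have hε₁ : 0 ≤ ε₁ := nonneg_of_mul_nonneg_right ((norm_nonneg _).trans hu₁) hC₀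
  have hε₂0 : 0 ≤ ε₂ := by rw [hε₂]; positivity
  have hηS (S : Submodule ℝ V) [FiniteDimensional ℝ S] (hS : VH ≤ S) (x : E) :
      ‖K x - (S.map (J : V →ₗ[ℝ] E)).starProjection (K x)‖ ≤ P.eta VH * ‖x‖ :=
    (norm_sub_starProjection_le_norm_sub _ (Submodule.map_mono hS
      (Submodule.starProjection_apply_mem _ _))).trans
      (norm_map_sub_starProjection_le_eta hJ hK VH x)
  have hclose (S : Submodule ℝ V) [FiniteDimensional ℝ S] (hS : VH ≤ S) (x : E) :
      ‖K x - galerkinOp K (S.map (J : V →ₗ[ℝ] E)) x‖ ≤ 2 * P.eta VH * ‖x‖ :=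
    norm_sub_galerkinOp_le hKs (hηS S hS) hη0 x
  constructor
  · obtain ⟨ut, hut, hut'⟩ := Submodule.mem_map.1
      (Submodule.starProjection_apply_mem (V₂.map (J : V →ₗ[ℝ] E)) (lam₁ • K (J u₁)))
    obtain ⟨lam₂, u₂, h1, h2, h3⟩ := P.exists_isIthEigenvalue_isEigenpair
      (VH ⊔ Submodule.span ℝ {ut}) (i := i) (Nat.zero_lt_of_lt hi.1)
      (hi.le_finrank hJ hK _ (by linarith) (hclose _ le_sup_left)) u
    exact ⟨lam₂, u₂, ⟨ut, hut, (forall_a_eq_iff_eq_starProjection hJ hK hut).2 hut', h1, h2⟩, h3⟩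
  · rintro lam₂ u₂ ⟨ut, hut, hsource, hith, hpair⟩ hsign
    set S := VH ⊔ Submodule.span ℝ {ut}
    have hSV₂ : S ≤ V₂ := sup_le hHV₂ (by simpa using hut)
    have hVHS : VH ≤ S := le_sup_left
    have hutS : ut ∈ S := Submodule.mem_sup_right (Submodule.mem_span_singleton_self ut)
    have hlam₂ := hith.pos
    have hu₂S : u₂ ∈ S := hpair.1.1
    have hδS : ‖J u - (S.map (J : V →ₗ[ℝ] E)).starProjection (J u)‖ ≤ D * ε₂ := by
      rcases le_total ε₁ 1 with hle | hge
      · have h1 := norm_sub_starProjection_le_norm_sub (J u)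
          (Submodule.mem_map_of_mem hutS : J ut ∈ S.map (J : V →ₗ[ℝ] E))
        have h2 := norm_sub_starProjection_smul_map_le hμ (inv_inv lam).symm huK
          hC₀.le hη0 hε₁ hle hδ
          hu₁ hu₁neg hlam₁ ((forall_a_eq_iff_eq_starProjection hJ hK hut).1 hsource)
        rw [← hε₂] at h2
        have h3 : 0 ≤ ‖J u‖ * ε₂ := by positivity
        refine h1.trans (h2.trans ?_)
        rw [hD]
        linarith
      -- For `ε₁ ≥ 1` also `ε₂ ≥ 1`, and the projection error is at most `‖J u‖`.
      · have h1 : 1 ≤ ε₂ := by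
          have h2 : 1 ≤ ε₁ ^ 2 := one_le_pow₀ hge
          have h3 := mul_nonneg hη0 hε₁
          linarith
        refine (norm_sub_starProjection_le_norm _).trans ?_
        have h2 : ‖J u‖ ≤ D := le_add_of_nonneg_right (by positivity)
        exact h2.trans (le_mul_of_one_le_right hD0.le h1)
    -- Weyl's inequality in both directions between `⊤`, where the compression is `K`, and `S`.
    have hclose' : |lam₂⁻¹ - lam⁻¹| ≤ 2 * P.eta VH := by
      have h1 := hi.inv_le_inv_add hJ hK hc hith (c := 2 * P.eta VH) fun x => by
        rw [galerkinOp_eq_self htop]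
        exact hclose S hVHS x
      have h2 := hith.inv_le_inv_add hJ hK hc hi (c := 2 * P.eta VH) fun x => by
        rw [galerkinOp_eq_self htop, norm_sub_rev]
        exact hclose S hVHS x
      exact abs_le.2 ⟨by linarith, by linarith⟩
    obtain ⟨e1, e2, e3⟩ := herr (S.map (J : V →ₗ[ℝ] E)) (P.eta VH) lam₂⁻¹ (J u₂) (hηS S hVHS)
      hη0 hηγ hημ (Submodule.mem_map_of_mem hu₂S)
      (mem_eigenspace_iff.1 ((mem_eigenspace_iff_starProjection hJ hK hlam₂.ne').1 hpair.1))
      (by rw [inner_map_of_energySpace hJ hK, hpair.2])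
      (by rwa [inner_map_of_energySpace hJ hK]) hclose'
    rw [inv_inv, inv_inv] at e3
    have hbound : ‖J u - J u₂‖ ≤ A * D * ε₂ := by
      refine e1.trans ?_
      rw [mul_assoc]
      gcongr
    rw [negNorm_eq_norm hJ hK, energyNorm_eq_norm hJ, map_sub]
    refine ⟨hSV₂ hu₂S, hbound.trans ?_, e2.trans ?_, e3.trans ?_⟩
    · refine mul_le_mul_of_nonneg_right ?_ hε₂0
      have : 0 ≤ A + A * (A * D) ^ 2 := by positivity
      linarith
    · refine mul_le_mul_of_nonneg_right ?_ (by positivity)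
      have : 0 ≤ A * D + A * (A * D) ^ 2 := by positivity
      linarith
    · have h1 : A * ‖J u - J u₂‖ ^ 2 ≤ A * (A * D * ε₂) ^ 2 := by gcongr
      have h2 : 0 ≤ (A * D + A) * ε₂ ^ 2 := by positivity
      rw [mul_pow] at h1
      linarith
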